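/- Fourier transforms are normalized by $\hat f(\omega)=\int_{\mathbb R^m} f(t)e^{-2\pi i t\cdot\omega}\,dt$, $T_\lambda f(t)=f(t-\lambda)$, and $W(L^2,\ell^1)$ is the Wiener amalgam space of measurable $f:\mathbb R^m\to\mathbb C$ with $\sum_{k\in\mathbb Z^m}\|f\,\mathbf 1_{[0,1]^m+k}\|_{2}<\infty$. Let $\Gamma\subset\mathbb R^m\times\mathbb R$ be a lattice such that the orthogonal projections $p_1$ onto $\mathbb R^m$ and $p_2$ onto $\mathbb R$ are injective on $\Gamma$ and $p_1(\Gamma)$, $p_2(\Gamma)$ are dense. Let $\Gamma^*=\{\eta\in\mathbb R^m\times\mathbb R:\ \gamma\cdot\eta\in\mathbb Z\text{ for all }\gamma\in\Gamma\}$ be the dual lattice and write $\eta=(p_1^*(\eta),p_2^*(\eta))$. Let $\Omega\subset\mathbb R$ be a non-empty compact interval that is the closure of its interior, is symmetric around the origin, and whose boundary is disjoint from $p_2(\Gamma)$. Let $\Lambda(\Omega)=\{p_1(\gamma):\gamma\in\Gamma,\ p_2(\gamma)\in\Omega\}$ (a simple generic model set). Its density $$D(\Lambda(\Omega))=\lim_{R\to\infty}\frac{\#\big(\Lambda(\Omega)\cap(R[0,1]^m+x)\big)}{R^m}$$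 exists for every $x\in\mathbb R^m$ and does not depend on $x$. Fix $0<\epsilon<1$ and put $\Omega_n=(1-\epsilon^n)\Omega$, $\operatorname{sinc}(t)=\frac{\sin \pi t}{\pi t}$ (with $\operatorname{sinc}(0)=1$) and $\hat\psi_n(t)=\prod_{s=0}^\infty\operatorname{sinc}\big(t\,|\epsilon^{ns}\Omega_n|\big)$. The sequence $\hat\psi_n$ converges uniformly on $\mathbb R$ to a function $\Psi$; put $\Phi=|\Omega|\,(\Psi*\Psi)$. Theorem 4.7. Let $\mathcal K$ be a countable set and $g_k\in W(L^2,\ell^1)$ for every $k\in\mathcal K$. Then the family $\{T_\lambda g_k:k\in\mathcal K,\ \lambda\in\Lambda(\Omega)\}$ is a normalized tight frame for $L^2(\mathbb R^m)$, that is, $$\sum_{k\in\mathcal K}\sum_{\lambda\in\Lambda(\Omega)}|\langle f,T_\lambda g_k\rangle|^2=\|f\|_2^2\quad\text{for all } f\in L^2(\mathbb R^m),$$ if and only if, for each $\eta\in\Gamma^*$ and for a.e. $t\in\mathbb R^m$, the series below converges absolutely and $$D(\Lambda(\Omega))\,\Phi(-p_2^*(\eta))\sum_{k\in\mathcal K}\overline{\hat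 g_k(t)}\,\hat g_k(t-p_1^*(\eta))=\delta_{\eta,0},$$ where $\delta_{\eta,0}=1$ if $\eta=0$ and $\delta_{\eta,0}=0$ otherwise. -/

import Mathlib

open MeasureTheory Filter Topology
open scoped ENNReal Pointwise FourierTransform

noncomputable section

namespace ModelSetFrames

/-- `ℝ^m` with its Euclidean structure. -/
abbrev Rm (m : ℕ) : Type := EuclideanSpace ℝ (Fin m)

/-- The Hilbert space `L²(ℝ^m)` of complex-valued functions. -/
abbrev L2 (m : ℕ) : Type := Lp ℂ 2 (volume : Measure (Rm m))

/-- The closed cube `[0,1]^m + k`. -/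
def unitCube {m : ℕ} (k : Fin m → ℤ) : Set (Rm m) :=
  {x | ∀ i, (k i : ℝ) ≤ x i ∧ x i ≤ (k i : ℝ) + 1}

/-- The Wiener amalgam norm `‖f‖_{p,q}`: the `ℓ^q` norm over `k ∈ ℤ^m` of the `L^p` norms of
`f · 1_{[0,1]^m + k}`. -/
def wienerNorm {m : ℕ} (p q : ℝ≥0∞) (f : Rm m → ℂ) : ℝ≥0∞ :=
  eLpNorm (fun k : Fin m → ℤ => eLpNorm ((unitCube k).indicator f) p volume) q Measure.count

/-- Membership in the Wiener amalgam space `W(L^p, ℓ^q)`. -/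
def MemWiener {m : ℕ} (p q : ℝ≥0∞) (f : Rm m → ℂ) : Prop :=
  AEStronglyMeasurable f volume ∧ wienerNorm p q f < ∞

/-- The translation operator `T_a f (t) = f (t - a)` on `L²(ℝ^m)`. -/
def translateL2 {m : ℕ} (a : Rm m) (f : L2 m) : L2 m :=
  Lp.compMeasurePreserving (fun t => t - a) (measurePreserving_sub_right volume a) f

/-- A family in a complex Hilbert space is a normalized tight frame if
`∑ᵢ |⟨f, φᵢ⟩|² = ‖f‖²` for every `f`. -/
def IsNormalizedTightFrame {ι H : Type*} [NormedAddCommGroup H] [InnerProductSpace ℂ H]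
    (φ : ι → H) : Prop :=
  ∀ f : H, HasSum (fun i => ‖inner ℂ (φ i) f‖ ^ 2) (‖f‖ ^ 2)

/-- The conditions on the two projections of `Γ ⊆ ℝ^m × ℝ`: both are injective on `Γ` and have
dense image. -/
structure IsCutAndProject {m : ℕ} (Γ : Submodule ℤ (Rm m × ℝ)) : Prop where
  injOn_fst : Set.InjOn Prod.fst (Γ : Set (Rm m × ℝ))
  dense_fst : Dense (Prod.fst '' (Γ : Set (Rm m × ℝ)))
  injOn_snd : Set.InjOn Prod.snd (Γ : Set (Rm m × ℝ))
  dense_snd : Dense (Prod.snd '' (Γ : Set (Rm m × ℝ)))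

/-- The dual lattice with respect to the inner product of the orthogonal sum `ℝ^m × ℝ`. -/
def dualLattice {m : ℕ} (Γ : Submodule ℤ (Rm m × ℝ)) : Set (Rm m × ℝ) :=
  {η | ∀ γ ∈ Γ, ∃ n : ℤ, inner ℝ γ.1 η.1 + γ.2 * η.2 = n}

/-- Windows of simple model sets: nonempty compact intervals that are the closure of their
interior and have a boundary of measure zero. -/
structure IsSimpleWindow (Ω : Set ℝ) : Prop where
  nonempty : Ω.Nonempty
  isCompact : IsCompact Ω
  closure_interior : closure (interior Ω) = Ω
  volume_frontier : volume (frontier Ω) = 0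
  ordConnected : Ω.OrdConnected

/-- The model set `Λ(Ω) = {p₁(γ) : γ ∈ Γ, p₂(γ) ∈ Ω}`. -/
def modelSet {m : ℕ} (Γ : Submodule ℤ (Rm m × ℝ)) (Ω : Set ℝ) : Set (Rm m) :=
  {x | ∃ γ ∈ Γ, γ.1 = x ∧ γ.2 ∈ Ω}

/-- The boundary of the window does not meet `p₂(Γ)`. -/
def IsGeneric {m : ℕ} (Γ : Submodule ℤ (Rm m × ℝ)) (Ω : Set ℝ) : Prop :=
  ∀ γ ∈ Γ, γ.2 ∉ frontier Ω

/-- The cube `R[0,1]^m + x`. -/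
def cube {m : ℕ} (x : Rm m) (R : ℝ) : Set (Rm m) :=
  {y | ∀ i, x i ≤ y i ∧ y i ≤ x i + R}

/-- `S` has density `D`: for every centre `x`, `#(S ∩ (R[0,1]^m + x)) / R^m → D`. -/
def HasDensity {m : ℕ} (S : Set (Rm m)) (D : ℝ) : Prop :=
  ∀ x : Rm m, Tendsto (fun R : ℝ => ((S ∩ cube x R).ncard : ℝ) / R ^ m) atTop (𝓝 D)

/-- `ψ̂_n(t) = ∏_{s ≥ 0} sinc (t |ε^{ns} Ω_n|)` with `Ω_n = (1 - ε^n) Ω` and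
`sinc t = sin (π t) / (π t)`. -/
def psiHat (ε : ℝ) (Ω : Set ℝ) (n : ℕ) (t : ℝ) : ℝ :=
  ∏' s : ℕ, Real.sinc (Real.pi * (t * volume.real (ε ^ (n * s) • ((1 - ε ^ n) • Ω))))

/-- `Φ = |Ω| · (Ψ * Ψ)`. -/
def Phi (Ω : Set ℝ) (Ψ : ℝ → ℝ) (t : ℝ) : ℝ :=
  volume.real Ω * ∫ x, Ψ x * Ψ (t - x)

open Classical in
/-- The Kronecker delta `δ_{η,0}`. -/
def kroneckerZero {m : ℕ} (η : Rm m × ℝ) : ℂ := if η = 0 then 1 else 0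

end ModelSetFrames

end

/-!
The frame sum of `f` is a value of a function on the torus `(ℝ^m × ℝ) / Γ`. Put
`w_f(y) = ∑ₖ |⟨f, T_y gₖ⟩|²` (`translateEnergy`) and `P_f(y, u) = w_f(y) 1_Ω(u)`
(`windowedEnergy`). Then `∑_{γ ∈ Γ} P_f(γ + z)` at `z = 0` is the frame sum of `f`, at `z = (x, 0)`
it is the frame sum of the translate `T_{-x} f`, and moving the second coordinate of `z` moves the
window.

*From a point to the torus.* For fixed `x` the value at `(x, s)` is the mass of `Ω - s` under a
measure on `ℝ` carried by `p₂(Γ)`. A measure giving the same finite mass to a dense set of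
translates of an interval gives this mass to every translate whose left endpoint is not an atom
(`measure_Icc_eq_of_dense`). If the family is a normalized tight frame, invariance under `Γ` gives
the value `‖f‖²` for all `s ∈ p₂(Γ)`, hence almost everywhere. Conversely, if the periodization is
`‖f‖²` almost everywhere for each `f`, genericity of the window gives the frame identity for almost
all translates of `f`, so for a dense set of functions, and then for all of them
(`isNormalizedTightFrame_of_dense`). This is `isNormalizedTightFrame_iff_ae`.

*Fourier coefficients on the torus.* A nonnegative periodization is almost everywhere equal to a
constant exactly when the Fourier transform of the periodized function vanishes on `Γ* \ {0}`
(`integral_prodChar_of_periodize_eq`, `periodize_eq_of_integral_prodChar`). By Plancherel's formula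
the transform of `P_f` at `η` is `|Ω| sinc(π |Ω| η₂)` times
`∫ (∑ₖ conj ĝₖ(t) ĝₖ(t - η₁)) f̂(t) conj f̂(t - η₁) dt` (`integral_windowedEnergy_prodChar`). At
`η = 0` this forces `∑ₖ |ĝₖ|²` to be constant, which bounds all the series by Cauchy-Schwarz, and
polarization in `f` (`ae_eq_zero_of_quadratic_form`) removes the integral. The result is
`forall_periodize_iff`.

*The constants.* The functions `ψ̂ₙ` converge uniformly to `sinc(π |Ω| t)`, the Fourier transform of
the normalized indicator function of `Ω`, and Plancherel's formula gives `Φ = sinc(π |Ω| ·)`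
(`tendstoUniformly_psiHat`, `Phi_Icc`). The density is `|Ω| / covol(Γ)` (`hasDensity_modelSet`): the
average over the torus of the number of points in a translated box is exact, and density of `p₂(Γ)`
makes all translates comparable up to a slight change of the box.
-/

set_option linter.unusedSectionVars false

namespace ModelSetFrames

/-! ### Plancherel's formula for Fourier integrals -/

section Plancherel

variable {E : Type*} [NormedAddCommGroup E] [InnerProductSpace ℝ E] [FiniteDimensional ℝ E]
  [MeasurableSpace E] [BorelSpace E]

/-- Moving the Fourier transform from one integrable factor to the other. -/
lemma integral_fourier_mul_eq {f h : E → ℂ} (hf : Integrable f) (hh : Integrable h) :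
    ∫ x, 𝓕 f x * h x = ∫ x, f x * 𝓕 h x := by
  have := VectorFourier.integral_fourierIntegral_smul_eq_flip (L := innerₗ E)
    Real.continuous_fourierChar continuous_inner hf hh
  simpa using! this

lemma continuous_fourier {f : E → ℂ} (hf : Integrable f) : Continuous (𝓕 f) :=
  VectorFourier.fourierIntegral_continuous Real.continuous_fourierChar
    (L := innerₗ E) continuous_inner hf

lemma norm_fourier_le (f : E → ℂ) (t : E) : ‖𝓕 f t‖ ≤ ∫ x, ‖f x‖ :=
  VectorFourier.norm_fourierIntegral_le_integral_norm _ _ _ _ _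

/-- On `L¹ ∩ L²` the `L²` Fourier transform is given by the Fourier integral: both have the same
integrals against test functions. -/
lemma fourier_toLp_ae_eq {f : E → ℂ} (hf : Integrable f) (hf2 : MemLp f 2) :
    ((𝓕 (hf2.toLp f : Lp ℂ 2 (volume : Measure E)) : Lp ℂ 2 (volume : Measure E)) : E → ℂ)
      =ᵐ[volume] 𝓕 f := by
  refine ae_eq_of_integral_contDiff_smul_eq
    ((Lp.memLp _).locallyIntegrable (by norm_num))
    (continuous_fourier hf).locallyIntegrable fun g hg hgc => ?_
  have hgC : ContDiff ℝ (↑(⊤ : ℕ∞)) fun x => (g x : ℂ) := Complex.ofRealCLM.contDiff.comp hg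
  have hgcC : HasCompactSupport fun x => (g x : ℂ) := hgc.comp_left (g := ((↑) : ℝ → ℂ)) (by simp)
  set φ : SchwartzMap E ℂ := hgcC.toSchwartzMap hgC with hφ
  have hφx : ∀ x, φ x = (g x : ℂ) := fun x => rfl
  have h1 := congrArg (fun T => T φ) (Lp.fourier_toTemperedDistribution_eq (hf2.toLp f))
  simp only [TemperedDistribution.fourier_apply, Lp.toTemperedDistribution_apply, smul_eq_mul,
    SchwartzMap.fourier_coe] at h1
  have h2 : ∫ x, 𝓕 (φ : E → ℂ) x * (hf2.toLp f : E → ℂ) x = ∫ x, 𝓕 (φ : E → ℂ) x * f x :=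
    integral_congr_ae (by filter_upwards [hf2.coeFn_toLp] with x hx; rw [hx])
  rw [h2, integral_fourier_mul_eq φ.integrable hf] at h1
  simpa [hφx] using h1.symm

lemma memLp_two_fourier {f : E → ℂ} (hf : Integrable f) (hf2 : MemLp f 2) : MemLp (𝓕 f) 2 :=
  (memLp_congr_ae (fourier_toLp_ae_eq hf hf2)).1 (Lp.memLp _)

/-- Plancherel's formula on `L¹ ∩ L²`, for Fourier integrals. -/
lemma integral_conj_fourier_mul_fourier {f h : E → ℂ} (hf : Integrable f) (hf2 : MemLp f 2)
    (hh : Integrable h) (hh2 : MemLp h 2) :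
    ∫ x, (starRingEnd ℂ) (𝓕 f x) * 𝓕 h x = ∫ x, (starRingEnd ℂ) (f x) * h x := by
  have h1 := Lp.inner_fourier_eq (hf2.toLp f) (hh2.toLp h)
  rw [L2.inner_def, L2.inner_def] at h1
  convert h1 using 1
  · refine integral_congr_ae ?_
    filter_upwards [fourier_toLp_ae_eq hf hf2, fourier_toLp_ae_eq hh hh2] with x h1 h2
    rw [h1, h2, RCLike.inner_apply, mul_comm]
  · refine integral_congr_ae ?_
    filter_upwards [hf2.coeFn_toLp, hh2.coeFn_toLp] with x h1 h2
    rw [h1, h2, RCLike.inner_apply, mul_comm]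

lemma fourier_comp_sub_right (f : E → ℂ) (a y : E) :
    𝓕 (fun t => f (t - a)) y = (Real.fourierChar (-inner ℝ a y) : ℂ) * 𝓕 f y := by
  rw [Real.fourier_eq, Real.fourier_eq, ← integral_sub_right_eq_self _ (-a), ← integral_const_mul]
  refine integral_congr_ae (.of_forall fun v => ?_)
  simp only [sub_neg_eq_add, add_sub_cancel_right, inner_add_left, neg_add, Circle.smul_def,
    smul_eq_mul, AddChar.map_add_eq_mul, Circle.coe_mul]
  ring

end Plancherel

/-! ### Cardinal sines -/

section Sinc

open Real

lemma abs_sinc_le_inv_abs (x : ℝ) (hx : x ≠ 0) : |sinc x| ≤ |x|⁻¹ := by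
  rw [sinc_of_ne_zero hx, abs_div, div_eq_mul_inv]
  exact mul_le_of_le_one_left (by positivity) (abs_sin_le_one x)

lemma abs_sinc_sub_one_le (x : ℝ) : |sinc x - 1| ≤ |x| := by
  wlog hx : 0 ≤ x generalizing x
  · simpa using this (-x) (by linarith)
  rcases hx.eq_or_lt with rfl | hx
  · simp
  rw [abs_of_nonpos (by linarith [sinc_le_one x]), abs_of_pos hx, sinc_of_ne_zero hx.ne']
  have key : x - x ^ 2 ≤ sin x := by
    rcases le_total x 1 with h1 | h1
    · have := sin_gt_sub_cube hx
      nlinarith [mul_pos hx hx]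
    · rcases le_total x π with h2 | h2
      · nlinarith [sin_nonneg_of_nonneg_of_le_pi hx.le h2]
      · nlinarith [neg_one_le_sin x, pi_gt_three]
  have : (x - x ^ 2) / x ≤ sin x / x := by gcongr
  rw [show (x - x ^ 2) / x = 1 - x by field_simp] at this
  linarith

lemma abs_prod_sub_one_le {ι : Type*} (s : Finset ι) (f : ι → ℝ) (hf : ∀ i, |f i| ≤ 1) :
    |∏ i ∈ s, f i - 1| ≤ ∑ i ∈ s, |f i - 1| := by
  classical
  induction s using Finset.induction_on with
  | empty => simp
  | insert i s hi ih =>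
    rw [Finset.prod_insert hi, Finset.sum_insert hi]
    calc |f i * ∏ j ∈ s, f j - 1| = |f i * (∏ j ∈ s, f j - 1) + (f i - 1)| := by ring_nf
      _ ≤ |f i| * |∏ j ∈ s, f j - 1| + |f i - 1| := by
        rw [← abs_mul]; exact abs_add_le _ _
      _ ≤ 1 * ∑ j ∈ s, |f j - 1| + |f i - 1| := by
        gcongr
        exact hf i
      _ = _ := by ring

/-- The estimate is uniform in `a` because a large value of `a` is absorbed by the decay of the
first factor of the product. -/
lemma abs_tprod_sinc_sub_sinc_le (a q : ℝ) (hq0 : 0 ≤ q) (hq1 : q < 1) :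
    |∏' s : ℕ, sinc (a * (q ^ s * (1 - q))) - sinc a| ≤ 3 * (q / (1 - q)) := by
  have hq : 0 < 1 - q := by linarith
  rcases eq_or_ne a 0 with rfl | ha
  · simpa using by positivity
  set v := a * (1 - q) with hv
  have hv0 : v ≠ 0 := mul_ne_zero ha hq.ne'
  have hterm : ∀ s : ℕ, a * (q ^ s * (1 - q)) = v * q ^ s := fun s => by rw [hv]; ring
  simp only [hterm]
  have hbd : ∀ s : ℕ, |sinc (v * q ^ s) - 1| ≤ |v| * q ^ s := fun s => by
    refine (abs_sinc_sub_one_le _).trans_eq ?_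
    rw [abs_mul, abs_of_nonneg (pow_nonneg hq0 s)]
  have hsum : Summable fun s : ℕ => |v| * q ^ s :=
    (summable_geometric_of_lt_one hq0 hq1).mul_left _
  have hmul : Multipliable fun s : ℕ => sinc (v * q ^ s) := by
    have := multipliable_one_add_of_summable (f := fun s : ℕ => sinc (v * q ^ s) - 1)
      (Summable.of_nonneg_of_le (fun _ => norm_nonneg _) hbd hsum)
    simpa using this
  have hlim := (hmul.hasProd.tendsto_prod_nat).comp (tendsto_add_atTop_nat 1)
  have hfirst : |sinc v - sinc a| ≤ 2 * (q / (1 - q)) := by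
    rw [sinc_of_ne_zero hv0, sinc_of_ne_zero ha]
    have e : sin v / v - sin a / a = (sin v - sin a) / v + sin a / v * q := by
      rw [hv]; field_simp; ring
    have h1 : |sin v - sin a| ≤ |a| * q := by
      have h := abs_sin_sub_sin_le v a
      rwa [show v - a = -(a * q) by rw [hv]; ring, abs_neg, abs_mul, abs_of_nonneg hq0] at h
    have h2 : |sin a| ≤ |a| := abs_sin_le_abs
    have hva : |v| = |a| * (1 - q) := by rw [hv, abs_mul, abs_of_pos hq]
    have hapos : 0 < |a| := abs_pos.2 ha
    rw [e]
    calc _ ≤ |(sin v - sin a) / v| + |sin a / v * q| := abs_add_le _ _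
      _ = |sin v - sin a| / (|a| * (1 - q)) + |sin a| / (|a| * (1 - q)) * q := by
        rw [abs_div, abs_mul (sin a / v), abs_div (sin a) v, hva, abs_of_nonneg hq0]
      _ ≤ (|a| * q) / (|a| * (1 - q)) + |a| / (|a| * (1 - q)) * q := by gcongr
      _ = 2 * (q / (1 - q)) := by field_simp; ring
  have hfin : ∀ N : ℕ, |∏ s ∈ Finset.range (N + 1), sinc (v * q ^ s) - sinc a|
      ≤ 3 * (q / (1 - q)) := fun N => by
    rw [Finset.prod_range_succ']
    have hrest := abs_prod_sub_one_le (Finset.range N) (fun s => sinc (v * q ^ (s + 1)))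
      fun _ => abs_sinc_le_one _
    have hgeo : ∑ s ∈ Finset.range N, |sinc (v * q ^ (s + 1)) - 1| ≤ |v| * (q / (1 - q)) :=
      calc _ ≤ ∑ s ∈ Finset.range N, |v| * q * q ^ s :=
            Finset.sum_le_sum fun s _ => (hbd (s + 1)).trans_eq (by ring)
        _ = |v| * q * ∑ s ∈ Finset.range N, q ^ s := by rw [Finset.mul_sum]
        _ ≤ |v| * q * (1 - q)⁻¹ := by
            gcongr
            rw [← tsum_geometric_of_lt_one hq0 hq1]
            exact (summable_geometric_of_lt_one hq0 hq1).sum_le_tsum _ fun _ _ => by positivity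
        _ = _ := by rw [div_eq_mul_inv]; ring
    set p := ∏ s ∈ Finset.range N, sinc (v * q ^ (s + 1))
    have hv1 : |sinc v| * |v| ≤ 1 := by
      have := abs_sinc_le_inv_abs v hv0
      calc _ ≤ |v|⁻¹ * |v| := by gcongr
        _ = 1 := inv_mul_cancel₀ (abs_ne_zero.2 hv0)
    have hqq : 0 ≤ q / (1 - q) := by positivity
    calc |p * sinc (v * q ^ 0) - sinc a|
          = |sinc v * (p - 1) + (sinc v - sinc a)| := by rw [pow_zero, mul_one]; ring_nf
      _ ≤ |sinc v| * |p - 1| + |sinc v - sinc a| := by rw [← abs_mul]; exact abs_add_le _ _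
      _ ≤ |sinc v| * (|v| * (q / (1 - q))) + 2 * (q / (1 - q)) := by
        gcongr
        exact hrest.trans hgeo
      _ ≤ 1 * (q / (1 - q)) + 2 * (q / (1 - q)) := by
        rw [← mul_assoc]; gcongr
      _ = _ := by ring
  exact le_of_tendsto ((hlim.sub_const _).abs) (.of_forall hfin)

lemma psiHat_eq {ε : ℝ} (hε0 : 0 < ε) (hε1 : ε < 1) (Ω : Set ℝ) (n : ℕ) (t : ℝ) :
    psiHat ε Ω n t =
      ∏' s : ℕ, sinc (π * volume.real Ω * t * ((ε ^ n) ^ s * (1 - ε ^ n))) := by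
  unfold psiHat
  congr 1
  ext s
  have h1 : ε ^ n ≤ 1 := pow_le_one₀ hε0.le hε1.le
  simp only [Measure.real, Measure.addHaar_smul, Module.finrank_self, pow_one, ENNReal.toReal_mul]
  rw [ENNReal.toReal_ofReal (abs_nonneg _), ENNReal.toReal_ofReal (abs_nonneg _),
    abs_of_pos (by positivity), abs_of_nonneg (by linarith), pow_mul]
  ring_nf

/-- The limit of `ψ̂ₙ` is its first factor: the product of the others tends to `1`. -/
lemma tendstoUniformly_psiHat {ε : ℝ} (hε0 : 0 < ε) (hε1 : ε < 1) (Ω : Set ℝ) :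
    TendstoUniformly (psiHat ε Ω) (fun t => sinc (π * volume.real Ω * t)) atTop := by
  rw [Metric.tendstoUniformly_iff]
  intro δ hδ
  have hq : Tendsto (fun n : ℕ => ε ^ n) atTop (𝓝 0) :=
    tendsto_pow_atTop_nhds_zero_of_lt_one hε0.le hε1
  have hlim : Tendsto (fun n : ℕ => 3 * (ε ^ n / (1 - ε ^ n))) atTop (𝓝 0) := by
    have := (hq.div (tendsto_const_nhds.sub hq) (by norm_num : (1 : ℝ) - 0 ≠ 0)).const_mul 3
    simpa using this
  filter_upwards [hlim.eventually_lt_const hδ, eventually_gt_atTop 0] with n hn hn0 t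
  rw [dist_comm, Real.dist_eq, psiHat_eq hε0 hε1]
  exact (abs_tprod_sinc_sub_sinc_le _ _ (by positivity)
    (pow_lt_one₀ hε0.le hε1 hn0.ne')).trans_lt hn

/-- The Fourier transform of the indicator function of a symmetric interval. -/
lemma fourier_indicator_Icc {b : ℝ} (hb : 0 ≤ b) (t : ℝ) :
    𝓕 ((Set.Icc (-b) b).indicator fun _ => (1 : ℂ)) t = (2 * b * sinc (π * (2 * b) * t) : ℝ) := by
  rw [Real.fourier_eq]
  have h1 : ∀ v : ℝ, Real.fourierChar (-inner ℝ v t) • (Set.Icc (-b) b).indicator (fun _ => (1 : ℂ)) v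
      = (Set.Icc (-b) b).indicator
        (fun v : ℝ => Complex.exp ((-(2 * π * t) * Complex.I) * v)) v := fun v => by
    by_cases hv : v ∈ Set.Icc (-b) b
    · simp only [Set.indicator_of_mem hv, Circle.smul_def, Real.fourierChar_apply, smul_eq_mul,
        mul_one]
      congr 1
      simp
      ring
    · simp [hv]
  simp_rw [h1]
  rw [integral_indicator measurableSet_Icc, integral_Icc_eq_integral_Ioc,
    ← intervalIntegral.integral_of_le (by linarith)]
  rcases eq_or_ne t 0 with rfl | ht
  · simp; ring
  rcases hb.eq_or_lt with rfl | hb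
  · simp
  have hc : (-(2 * π * t) * Complex.I : ℂ) ≠ 0 := by
    simp [ht, Real.pi_ne_zero]
  rw [integral_exp_mul_complex hc, sinc_of_ne_zero (by positivity)]
  have ht' : (t : ℂ) ≠ 0 := by exact_mod_cast ht
  have hb' : (b : ℂ) ≠ 0 := by exact_mod_cast hb.ne'
  have hp' : (π : ℂ) ≠ 0 := by exact_mod_cast Real.pi_ne_zero
  push_cast
  rw [Complex.sin]
  rw [show (-(π * (2 * b) * t) * Complex.I : ℂ) = -(2 * π * t) * Complex.I * b by ring,
    show (π * (2 * b) * t * Complex.I : ℂ) = -(2 * π * t) * Complex.I * (-b) by ring]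
  generalize Complex.exp (-(2 * π * t) * Complex.I * b) = x
  generalize Complex.exp (-(2 * π * t) * Complex.I * (-b)) = y
  field_simp
  linear_combination (y - x) * Complex.I_sq

/-- The function `sinc` is, up to scaling, idempotent for convolution. -/
lemma Phi_Icc {b : ℝ} (hb : 0 < b) (t : ℝ) :
    Phi (Set.Icc (-b) b) (fun t => sinc (π * volume.real (Set.Icc (-b) b) * t)) t =
      sinc (π * volume.real (Set.Icc (-b) b) * t) := by
  have hvol : volume.real (Set.Icc (-b) b) = 2 * b := by
    rw [Real.volume_real_Icc_of_le (by linarith)]; ring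
  rw [Phi, hvol]
  set f : ℝ → ℂ := (Set.Icc (-b) b).indicator fun _ => (1 : ℂ) with hf
  set h : ℝ → ℂ := fun u => (Real.fourierChar (u * t) : ℂ) * f u with hh
  have hfi : ∀ p, MemLp f p := fun p =>
    memLp_indicator_const p measurableSet_Icc _ (Or.inr (by simp))
  have hhi : ∀ p, MemLp h p := fun p => by
    refine (hfi p).of_le ?_ (.of_forall fun u => by
      rw [hh, norm_mul, Circle.norm_coe, one_mul])
    have hc : Continuous fun u : ℝ => (Real.fourierChar (u * t) : ℂ) :=
      continuous_subtype_val.comp (Real.continuous_fourierChar.comp (by fun_prop))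
    exact hc.aestronglyMeasurable.mul (hfi p).1
  have hFh : ∀ x, 𝓕 h x = 𝓕 f (x - t) := fun x => by
    rw [Real.fourier_eq, Real.fourier_eq]
    refine integral_congr_ae (.of_forall fun u => ?_)
    simp only [hh, Circle.smul_def, smul_eq_mul, ← mul_assoc, ← Circle.coe_mul,
      ← AddChar.map_add_eq_mul]
    congr 4
    simp; ring
  have hP := integral_conj_fourier_mul_fourier (memLp_one_iff_integrable.1 (hfi 1)) (hfi 2)
    (memLp_one_iff_integrable.1 (hhi 1)) (hhi 2)
  have hR : ∫ u, (starRingEnd ℂ) (f u) * h u = 𝓕 f (-t) := by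
    rw [Real.fourier_eq]
    refine integral_congr_ae (.of_forall fun u => ?_)
    by_cases hu : u ∈ Set.Icc (-b) b
    · simp [hh, hf, hu, Circle.smul_def, mul_comm]
    · simp [hh, hf, hu]
  rw [hR] at hP
  simp_rw [hFh, hf, fourier_indicator_Icc hb.le] at hP
  have hP' : ∫ x, (2 * b * sinc (π * (2 * b) * x)) * (2 * b * sinc (π * (2 * b) * (x - t)))
      = 2 * b * sinc (π * (2 * b) * (-t)) := by
    have : ∀ x : ℝ, (starRingEnd ℂ) ((2 * b * sinc (π * (2 * b) * x) : ℝ) : ℂ)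
        * ((2 * b * sinc (π * (2 * b) * (x - t)) : ℝ) : ℂ)
        = (((2 * b * sinc (π * (2 * b) * x)) * (2 * b * sinc (π * (2 * b) * (x - t))) : ℝ) : ℂ) :=
      fun x => by rw [Complex.conj_ofReal]; push_cast; rfl
    simp_rw [this] at hP
    rw [integral_complex_ofReal] at hP
    exact_mod_cast hP
  have e1 : ∀ x, (2 * b * sinc (π * (2 * b) * x)) * (2 * b * sinc (π * (2 * b) * (x - t)))
      = (2 * b) * (2 * b) * (sinc (π * (2 * b) * x) * sinc (π * (2 * b) * (t - x))) := fun x => by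
    rw [show π * (2 * b) * (x - t) = -(π * (2 * b) * (t - x)) by ring, sinc_neg]; ring
  simp_rw [e1] at hP'
  rw [integral_const_mul, mul_neg, sinc_neg, mul_assoc] at hP'
  exact mul_left_cancel₀ (by positivity) hP'

end Sinc

/-! ### Periodization over a lattice -/

section Periodization

variable {E : Type*} [NormedAddCommGroup E] [NormedSpace ℝ E] [FiniteDimensional ℝ E]
  [MeasurableSpace E] [BorelSpace E] (Γ : Submodule ℤ E) [DiscreteTopology Γ] [IsZLattice ℝ Γ]
  (μ : Measure E) [μ.IsAddHaarMeasure]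

instance vaddInvariantMeasure_lattice : VAddInvariantMeasure Γ E μ :=
  (inferInstance : VAddInvariantMeasure Γ.toAddSubgroup E μ)

/-- A bounded measurable fundamental domain of the lattice `Γ`. -/
lemma exists_fundamentalDomain : ∃ F : Set E, IsAddFundamentalDomain Γ F μ ∧ MeasurableSet F ∧
    Bornology.IsBounded F ∧ μ F = ENNReal.ofReal (ZLattice.covolume Γ μ) ∧
    (∀ z : E, ∃ γ : Γ, z - (γ : E) ∈ F) ∧ (∀ z ∈ F, ∀ w ∈ F, z - w ∈ Γ → z = w) := by
  set b := Module.Free.chooseBasis ℤ Γ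
  have hF := ZLattice.isAddFundamentalDomain b μ
  have hspan := b.ofZLatticeBasis_span ℝ
  refine ⟨_, hF, ZSpan.fundamentalDomain_measurableSet _, ZSpan.fundamentalDomain_isBounded _, ?_,
    fun z => ?_, fun z hz w hw hzw => ?_⟩
  · rw [ZLattice.covolume_eq_measure_fundamentalDomain Γ μ hF,
      ofReal_measureReal (ZSpan.fundamentalDomain_isBounded _).measure_lt_top.ne]
  · refine ⟨⟨ZSpan.floor (b.ofZLatticeBasis ℝ) z, ?_⟩, ZSpan.fract_mem_fundamentalDomain _ z⟩
    exact hspan.le (ZSpan.floor (b.ofZLatticeBasis ℝ) z).2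
  · rw [← ZSpan.fract_eq_self.2 hz, ← ZSpan.fract_eq_self.2 hw, ZSpan.fract_eq_fract, hspan]
    rw [← Γ.neg_mem_iff]
    convert hzw using 1
    abel

/-- The lattice periodization of a function. -/
noncomputable def periodize (P : E → ℝ≥0∞) (z : E) : ℝ≥0∞ := ∑' γ : Γ, P (γ + z)

variable {Γ}

lemma measurable_periodize {P : E → ℝ≥0∞} (hP : Measurable P) : Measurable (periodize Γ P) :=
  Measurable.tsum fun γ => hP.comp (measurable_const_add (γ : E))

lemma periodize_add (P : E → ℝ≥0∞) (z : E) (γ : Γ) :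
    periodize Γ P (z + γ) = periodize Γ P z := by
  unfold periodize
  rw [← (Equiv.addRight γ).tsum_eq (fun γ' : Γ => P (γ' + z))]
  refine tsum_congr fun γ' => ?_
  simp only [Equiv.coe_addRight, Submodule.coe_add]
  congr 1
  abel

lemma indicator_one_le {α β : Type*} {s : Set α} {t : Set β} {p : α} {q : β}
    (h : p ∈ s → q ∈ t) :
    s.indicator (fun _ => (1 : ℝ≥0∞)) p ≤ t.indicator (fun _ => 1) q := by
  by_cases hp : p ∈ s
  · rw [Set.indicator_of_mem hp, Set.indicator_of_mem (h hp)]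
  · rw [Set.indicator_of_notMem hp]; exact zero_le

lemma periodize_mono {P Q : E → ℝ≥0∞} (h : ∀ z, P z ≤ Q z) (z : E) :
    periodize Γ P z ≤ periodize Γ Q z :=
  ENNReal.tsum_le_tsum fun _ => h _

variable {μ}

lemma setLIntegral_periodize_mul {F : Set E} (hF : IsAddFundamentalDomain Γ F μ)
    {P h : E → ℝ≥0∞} (hP : Measurable P) (hh : Measurable h)
    (hper : ∀ (z : E) (γ : Γ), h (γ + z) = h z) :
    ∫⁻ z in F, periodize Γ P z * h z ∂μ = ∫⁻ z, P z * h z ∂μ := by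
  rw [hF.lintegral_eq_tsum'' fun z => P z * h z, ← lintegral_tsum]
  · refine lintegral_congr fun z => ?_
    rw [periodize, ← ENNReal.tsum_mul_right]
    exact tsum_congr fun γ => by rw [Submodule.vadd_def, vadd_eq_add, hper]
  · exact fun γ => ((hP.mul hh).comp (measurable_const_vadd γ)).aemeasurable

lemma setLIntegral_periodize {F : Set E} (hF : IsAddFundamentalDomain Γ F μ)
    {P : E → ℝ≥0∞} (hP : Measurable P) :
    ∫⁻ z in F, periodize Γ P z ∂μ = ∫⁻ z, P z ∂μ := by
  simpa using setLIntegral_periodize_mul hF hP (h := fun _ => 1) measurable_const (by simp)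

end Periodization

/-! ### The density of a model set -/

section Density

variable {m : ℕ}

instance isAddHaarMeasure_prod :
    Measure.IsAddHaarMeasure (volume : Measure (Rm m × ℝ)) := by
  rw [Measure.volume_eq_prod]; infer_instance

lemma volume_cube (x : Rm m) {R : ℝ} (hR : 0 ≤ R) :
    volume (cube x R) = ENNReal.ofReal (R ^ m) := by
  have h1 : cube x R = (MeasurableEquiv.toLp 2 (Fin m → ℝ)).symm ⁻¹'
      Set.Icc (fun i => x i) (fun i => x i + R) := by
    ext y
    simp [cube, Set.mem_Icc, Pi.le_def, forall_and]
  rw [h1, (EuclideanSpace.volume_preserving_symm_measurableEquiv_toLp (Fin m)).measure_preimage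
    measurableSet_Icc.nullMeasurableSet, Real.volume_Icc_pi]
  simp [ENNReal.ofReal_pow hR]

lemma measurableSet_cube (x : Rm m) (R : ℝ) : MeasurableSet (cube x R) := by
  have : IsClosed (cube x R) := by
    simp only [cube, Set.ofPred_forall, Set.ofPred_and]
    exact isClosed_iInter fun i => (isClosed_le (by fun_prop) (by fun_prop)).inter
      (isClosed_le (by fun_prop) (by fun_prop))
  exact this.measurableSet

variable {Γ : Submodule ℤ (Rm m × ℝ)} [DiscreteTopology Γ] [IsZLattice ℝ Γ]

/-- Modulo `Γ`, every point has a representative with small second coordinate and bounded first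
coordinate; this is where the density of `p₂(Γ)` enters. -/
lemma exists_lattice_approx (hΓ : Dense (Prod.snd '' (Γ : Set (Rm m × ℝ)))) {δ : ℝ} (hδ : 0 < δ) :
    ∃ r : ℝ, 0 ≤ r ∧ ∀ z : Rm m × ℝ, ∃ γ : Γ,
      ‖(z - (γ : Rm m × ℝ)).1‖ ≤ r ∧ |(z - (γ : Rm m × ℝ)).2| ≤ δ := by
  obtain ⟨F, -, -, hFb, -, hF, -⟩ := exists_fundamentalDomain Γ volume
  obtain ⟨M, hM⟩ := hFb.exists_norm_le
  -- finitely many lattice points have second coordinates forming a `δ`-net of `[-M, M]`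
  have hcov : Set.Icc (-M) M ⊆ ⋃ γ : Γ, Metric.ball (γ : Rm m × ℝ).2 δ := fun s _ => by
    obtain ⟨_, hd, ⟨γ, hγ, rfl⟩⟩ := Metric.dense_iff.1 hΓ s δ hδ
    exact Set.mem_iUnion.2 ⟨⟨γ, hγ⟩, by rwa [Metric.mem_ball, dist_comm]⟩
  obtain ⟨t, ht⟩ := isCompact_Icc.elim_finite_subcover _ (fun _ => Metric.isOpen_ball) hcov
  refine ⟨|M| + ∑ γ ∈ t, ‖(γ : Rm m × ℝ).1‖, by positivity, fun z => ?_⟩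
  obtain ⟨γ₁, h₁⟩ := hF z
  have hn := hM _ h₁
  have h1 : ‖(z - (γ₁ : Rm m × ℝ)).1‖ ≤ M := (norm_fst_le _).trans hn
  have h2 : ‖(z - (γ₁ : Rm m × ℝ)).2‖ ≤ M := (norm_snd_le _).trans hn
  have h3 := ht (abs_le.1 h2)
  simp only [Set.mem_iUnion, Metric.mem_ball, Real.dist_eq] at h3
  obtain ⟨γ₂, hγ₂, h4⟩ := h3
  refine ⟨γ₁ + γ₂, ?_, ?_⟩
  · have e : (z - ((γ₁ + γ₂ : Γ) : Rm m × ℝ)).1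
        = (z - (γ₁ : Rm m × ℝ)).1 - (γ₂ : Rm m × ℝ).1 := by
      simp [sub_sub]
    rw [e]
    calc _ ≤ ‖(z - (γ₁ : Rm m × ℝ)).1‖ + ‖(γ₂ : Rm m × ℝ).1‖ := norm_sub_le _ _
      _ ≤ |M| + ∑ γ ∈ t, ‖(γ : Rm m × ℝ).1‖ := by
        gcongr
        · exact h1.trans (le_abs_self M)
        · exact Finset.single_le_sum (f := fun γ : Γ => ‖(γ : Rm m × ℝ).1‖)
            (fun _ _ => norm_nonneg _) hγ₂
  · have e : (z - ((γ₁ + γ₂ : Γ) : Rm m × ℝ)).2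
        = (z - (γ₁ : Rm m × ℝ)).2 - (γ₂ : Rm m × ℝ).2 := by
      simp [sub_sub]
    rw [e]; exact h4.le

lemma periodize_indicator_zero_eq (hΓ : Set.InjOn Prod.fst (Γ : Set (Rm m × ℝ)))
    (C : Set (Rm m)) (I : Set ℝ) :
    periodize Γ ((C ×ˢ I).indicator fun _ => 1) 0 = (modelSet Γ I ∩ C).encard := by
  have h1 : modelSet Γ I ∩ C = Prod.fst '' ((Γ : Set (Rm m × ℝ)) ∩ (C ×ˢ I)) := by
    ext x
    constructor
    · rintro ⟨⟨γ, hγ, rfl, h2⟩, hC⟩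
      exact ⟨γ, ⟨hγ, hC, h2⟩, rfl⟩
    · rintro ⟨γ, ⟨hγ, hC, h2⟩, rfl⟩
      exact ⟨⟨γ, hγ, rfl, h2⟩, hC⟩
  rw [h1, (hΓ.mono Set.inter_subset_left).encard_image, ← ENNReal.tsum_set_one, periodize]
  simp only [add_zero]
  refine (tsum_subtype (Γ : Set (Rm m × ℝ)) ((C ×ˢ I).indicator fun _ => (1 : ℝ≥0∞))).trans ?_
  rw [tsum_subtype ((Γ : Set (Rm m × ℝ)) ∩ C ×ˢ I) fun _ => (1 : ℝ≥0∞), Set.indicator_indicator]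

lemma le_covolume_mul_of_forall {B : Set (Rm m × ℝ)} (hB : MeasurableSet B) {n : ℝ≥0∞}
    (h : ∀ z, periodize Γ (B.indicator fun _ => 1) z ≤ n) :
    volume B ≤ n * ENNReal.ofReal (ZLattice.covolume Γ volume) := by
  obtain ⟨F, hF, -, -, hvol, -⟩ := exists_fundamentalDomain Γ volume
  have h1 := setLIntegral_periodize hF (P := B.indicator fun _ => 1)
    (measurable_const.indicator hB)
  rw [lintegral_indicator_const hB, one_mul] at h1
  rw [← h1, ← hvol, ← setLIntegral_const]
  exact lintegral_mono fun z => h z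

lemma covolume_mul_le_of_forall {B : Set (Rm m × ℝ)} (hB : MeasurableSet B) {n : ℝ≥0∞}
    (h : ∀ z, n ≤ periodize Γ (B.indicator fun _ => 1) z) :
    n * ENNReal.ofReal (ZLattice.covolume Γ volume) ≤ volume B := by
  obtain ⟨F, hF, -, -, hvol, -⟩ := exists_fundamentalDomain Γ volume
  have h1 := setLIntegral_periodize hF (P := B.indicator fun _ => 1)
    (measurable_const.indicator hB)
  rw [lintegral_indicator_const hB, one_mul] at h1
  rw [← h1, ← hvol, ← setLIntegral_const]
  exact lintegral_mono fun z => h z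

lemma volume_cube_prod_Icc (x : Rm m) {R : ℝ} (hR : 0 ≤ R) (a b : ℝ) :
    volume (cube x R ×ˢ Set.Icc a b) = ENNReal.ofReal (R ^ m * (b - a)) := by
  rw [Measure.volume_eq_prod, Measure.prod_prod, volume_cube x hR, Real.volume_Icc,
    ENNReal.ofReal_mul (by positivity)]

/-- The vector `(r, …, r)`. -/
def diag (m : ℕ) (r : ℝ) : Rm m := WithLp.toLp 2 fun _ => r

/-- Counting estimates: the number of points in a cube is compared with averages, over all
translates, of the numbers of points in a slightly smaller and a slightly larger cube, with
slightly smaller and larger windows. -/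
lemma count_bounds (hΓ : IsCutAndProject Γ) (a b : ℝ) {δ : ℝ} (hδ : 0 < δ) :
    ∃ r : ℝ, 0 ≤ r ∧ ∀ (x : Rm m) (R : ℝ), 2 * r ≤ R →
      (R - 2 * r) ^ m * (b - a - 2 * δ) ≤
        (modelSet Γ (Set.Icc a b) ∩ cube x R).ncard * ZLattice.covolume Γ volume ∧
      (modelSet Γ (Set.Icc a b) ∩ cube x R).ncard * ZLattice.covolume Γ volume ≤
        (R + 2 * r) ^ m * max (b - a + 2 * δ) 0 := by
  obtain ⟨r, hr, hrδ⟩ := exists_lattice_approx (Γ := Γ) hΓ.dense_snd hδ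
  refine ⟨r, hr, fun x R hR => ?_⟩
  set n := (modelSet Γ (Set.Icc a b) ∩ cube x R) with hn
  have hV := ZLattice.covolume_pos Γ (volume : Measure (Rm m × ℝ))
  have hcount := periodize_indicator_zero_eq (Γ := Γ) hΓ.injOn_fst (cube x R) (Set.Icc a b)
  have hcoord : ∀ (w : Rm m) (i : Fin m), ‖w‖ ≤ r → |w i| ≤ r := fun w i hw =>
    (by simpa using PiLp.norm_apply_le w i : |w i| ≤ ‖w‖).trans hw
  -- up to a lattice vector, every translation vector is small in both coordinates
  have hred : ∀ (P : Rm m × ℝ → ℝ≥0∞) (z : Rm m × ℝ), ∃ w : Rm m × ℝ, ‖w.1‖ ≤ r ∧ |w.2| ≤ δ ∧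
      periodize Γ P z = periodize Γ (fun p => P (p + w)) 0 := fun P z => by
    obtain ⟨γ, h1, h2⟩ := hrδ z
    refine ⟨z - γ, h1, h2, ?_⟩
    rw [← sub_add_cancel z (γ : Rm m × ℝ), periodize_add, add_sub_cancel_right]
    simp [periodize]
  have lower : ENNReal.ofReal ((R - 2 * r) ^ m * (b - a - 2 * δ)) ≤
      n.encard * ENNReal.ofReal (ZLattice.covolume Γ volume) := by
    have := le_covolume_mul_of_forall (Γ := Γ)
      (B := cube (x + diag m r) (R - 2 * r) ×ˢ Set.Icc (a + δ) (b - δ)) (n := n.encard)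
      ((measurableSet_cube _ _).prod measurableSet_Icc) fun z => by
        obtain ⟨w, hw1, hw2, hw⟩ := hred ((cube (x + diag m r) (R - 2 * r) ×ˢ
          Set.Icc (a + δ) (b - δ)).indicator fun _ => 1) z
        rw [hw, hn, ← hcount]
        refine periodize_mono (fun p => ?_) 0
        refine indicator_one_le fun hp => ?_
        obtain ⟨h1, h2⟩ := hp
        refine ⟨fun i => ?_, ?_⟩
        · have := h1 i
          have h3 := abs_le.1 (hcoord w.1 i hw1)
          simp only [diag, PiLp.add_apply, Prod.fst_add] at this
          constructor <;> linarith [this.1, this.2, h3.1, h3.2]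
        · have h3 := abs_le.1 hw2
          simp only [Set.mem_Icc, Prod.snd_add] at h2
          constructor <;> linarith [h2.1, h2.2, h3.1, h3.2]
    rwa [volume_cube_prod_Icc _ (by linarith), show b - δ - (a + δ) = b - a - 2 * δ by ring] at this
  have upper : n.encard * ENNReal.ofReal (ZLattice.covolume Γ volume) ≤
      ENNReal.ofReal ((R + 2 * r) ^ m * (b - a + 2 * δ)) := by
    have := covolume_mul_le_of_forall (Γ := Γ)
      (B := cube (x - diag m r) (R + 2 * r) ×ˢ Set.Icc (a - δ) (b + δ)) (n := n.encard)
      ((measurableSet_cube _ _).prod measurableSet_Icc) fun z => by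
        obtain ⟨w, hw1, hw2, hw⟩ := hred ((cube (x - diag m r) (R + 2 * r) ×ˢ
          Set.Icc (a - δ) (b + δ)).indicator fun _ => 1) z
        rw [hw, hn, ← hcount]
        refine periodize_mono (fun p => ?_) 0
        refine indicator_one_le fun hp => ?_
        obtain ⟨h1, h2⟩ := hp
        refine ⟨fun i => ?_, ?_⟩
        · have := h1 i
          have h3 := abs_le.1 (hcoord w.1 i hw1)
          simp only [diag, PiLp.sub_apply, PiLp.add_apply, Prod.fst_add]
          constructor <;> linarith [this.1, this.2, h3.1, h3.2]
        · have h3 := abs_le.1 hw2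
          simp only [Set.mem_Icc, Prod.snd_add] at h2 ⊢
          constructor <;> linarith [h2.1, h2.2, h3.1, h3.2]
    rwa [volume_cube_prod_Icc _ (by linarith), show b + δ - (a - δ) = b - a + 2 * δ by ring] at this
  have hfin : n.Finite := by
    by_contra hinf
    rw [Set.not_finite.1 hinf |>.encard_eq, ENat.toENNReal_top, ENNReal.top_mul (by simpa using hV)]
      at upper
    exact absurd upper (by simp)
  rw [← hfin.cast_ncard_eq, ENat.toENNReal_coe, ← ENNReal.ofReal_natCast,
    ← ENNReal.ofReal_mul (by positivity)] at lower upper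
  have hpos : 0 ≤ (n.ncard : ℝ) * ZLattice.covolume Γ volume := by positivity
  refine ⟨(ENNReal.ofReal_le_ofReal_iff hpos).1 lower, ?_⟩
  have := ENNReal.toReal_mono ENNReal.ofReal_ne_top upper
  rw [ENNReal.toReal_ofReal hpos, ENNReal.toReal_ofReal'] at this
  have h0 : 0 ≤ (R + 2 * r) ^ m := pow_nonneg (by linarith) _
  exact this.trans (max_le (mul_le_mul_of_nonneg_left (le_max_left _ _) h0)
    (mul_nonneg h0 (le_max_right _ _)))

lemma tendsto_add_pow_div_pow (m : ℕ) (c : ℝ) :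
    Tendsto (fun R : ℝ => (R + c) ^ m / R ^ m) atTop (𝓝 1) := by
  have h1 : Tendsto (fun R : ℝ => 1 + c / R) atTop (𝓝 (1 + 0)) :=
    tendsto_const_nhds.add (tendsto_const_nhds.div_atTop tendsto_id)
  have h2 := h1.pow m
  rw [add_zero, one_pow] at h2
  refine h2.congr' ?_
  filter_upwards [eventually_gt_atTop 0] with R hR
  rw [← div_pow, add_div, div_self hR.ne']

/-- The density of a model set: length of the window divided by the covolume of the lattice. -/
lemma hasDensity_modelSet (hΓ : IsCutAndProject Γ) {a b : ℝ} (hab : a ≤ b) :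
    HasDensity (modelSet Γ (Set.Icc a b)) ((b - a) / ZLattice.covolume Γ volume) := by
  intro x
  set V := ZLattice.covolume Γ (volume : Measure (Rm m × ℝ))
  have hV : 0 < V := ZLattice.covolume_pos Γ (volume : Measure (Rm m × ℝ))
  rw [tendsto_order]
  constructor
  · intro y hy
    obtain ⟨δ, hδ, hyδ⟩ : ∃ δ > 0, y < (b - a - 2 * δ) / V := by
      refine ⟨((b - a) - y * V) / 4, ?_, ?_⟩
      · rw [lt_div_iff₀ hV] at hy; linarith
      · rw [lt_div_iff₀ hV] at hy ⊢; linarith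
    obtain ⟨r, hr, hb⟩ := count_bounds (Γ := Γ) hΓ a b hδ
    have hlim := (tendsto_add_pow_div_pow m (-(2 * r))).mul_const ((b - a - 2 * δ) / V)
    rw [one_mul] at hlim
    filter_upwards [hlim.eventually_const_lt hyδ, eventually_ge_atTop (2 * r),
      eventually_gt_atTop 0] with R h1 h2 h3
    refine h1.trans_le ?_
    rw [div_mul_div_comm, mul_comm (R ^ m) V, ← div_div, ← sub_eq_add_neg]
    gcongr
    rw [div_le_iff₀ hV]
    exact (hb x R h2).1
  · intro y hy
    replace hy : (b - a) / V < y := hy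
    obtain ⟨δ, hδ, hyδ⟩ : ∃ δ > 0, (b - a + 2 * δ) / V < y := by
      refine ⟨(y * V - (b - a)) / 4, ?_, ?_⟩
      · rw [div_lt_iff₀ hV] at hy; linarith
      · rw [div_lt_iff₀ hV] at hy ⊢; linarith
    obtain ⟨r, hr, hb⟩ := count_bounds (Γ := Γ) hΓ a b hδ
    have hlim := (tendsto_add_pow_div_pow m (2 * r)).mul_const ((b - a + 2 * δ) / V)
    rw [one_mul] at hlim
    filter_upwards [hlim.eventually_lt_const hyδ, eventually_ge_atTop (2 * r),
      eventually_gt_atTop 0] with R h1 h2 h3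
    refine lt_of_le_of_lt ?_ h1
    rw [div_mul_div_comm, mul_comm (R ^ m) V, ← div_div]
    gcongr
    rw [le_div_iff₀ hV]
    have := (hb x R h2).2
    rwa [max_eq_left (by linarith)] at this

end Density

/-! ### Fourier coefficients of measures on the torus -/

section TorusMeasures

variable {ι : Type*} [Fintype ι]

/-- A finite measure on the torus is determined by its Fourier coefficients. -/
lemma measure_ext_of_integral_mFourier {ν₁ ν₂ : Measure (UnitAddTorus ι)} [IsFiniteMeasure ν₁]
    [IsFiniteMeasure ν₂]
    (h : ∀ n : ι → ℤ, ∫ x, UnitAddTorus.mFourier n x ∂ν₁ = ∫ x, UnitAddTorus.mFourier n x ∂ν₂) :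
    ν₁ = ν₂ := by
  have hint : ∀ (ν : Measure (UnitAddTorus ι)) [IsFiniteMeasure ν] (g : C(UnitAddTorus ι, ℂ)),
      Integrable g ν := fun ν _ g => (BoundedContinuousFunction.mkOfCompact g).integrable ν
  refine ext_of_forall_mem_subalgebra_integral_eq_of_polish (𝕜 := ℂ)
    (A := (UnitAddTorus.mFourierSubalgebra ι).comap
      (BoundedContinuousFunction.toContinuousMapStarₐ ℂ)) ?_ fun g hg => ?_
  · intro x y hxy
    obtain ⟨_, ⟨f, hf, rfl⟩, hne⟩ := UnitAddTorus.mFourierSubalgebra_separatesPoints hxy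
    exact ⟨f, ⟨f, ⟨BoundedContinuousFunction.mkOfCompact f, hf, rfl⟩, rfl⟩, hne⟩
  · have hg' : BoundedContinuousFunction.toContinuousMapStarₐ ℂ g ∈
        Submodule.span ℂ (Set.range (UnitAddTorus.mFourier (d := ι))) := by
      rw [← UnitAddTorus.mFourierSubalgebra_coe]; exact hg
    have key : ∀ f ∈ Submodule.span ℂ (Set.range (UnitAddTorus.mFourier (d := ι))),
        ∫ x, f x ∂ν₁ = ∫ x, f x ∂ν₂ := fun f hf => by
      induction hf using Submodule.span_induction with
      | mem f hf => obtain ⟨n, rfl⟩ := hf; exact h n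
      | zero => simp
      | add f g _ _ h1 h2 =>
        simp only [ContinuousMap.add_apply]
        rw [integral_add (hint _ f) (hint _ g), integral_add (hint _ f) (hint _ g), h1, h2]
      | smul c f _ h1 =>
        simp only [ContinuousMap.smul_apply]
        rw [integral_smul, integral_smul, h1]
    exact key _ hg'

end TorusMeasures

/-! ### Fourier coefficients of periodizations -/

section Characters

variable {m : ℕ}

/-- The character `z ↦ exp (-2πi z·η)` of `ℝ^m × ℝ`. -/
noncomputable def prodChar (η z : Rm m × ℝ) : ℂ :=
  (Real.fourierChar (-(inner ℝ z.1 η.1 + z.2 * η.2)) : ℂ)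

lemma continuous_prodChar (η : Rm m × ℝ) : Continuous (prodChar η) :=
  continuous_subtype_val.comp (Real.continuous_fourierChar.comp (by fun_prop))

lemma norm_prodChar (η z : Rm m × ℝ) : ‖prodChar η z‖ = 1 := Circle.norm_coe _

lemma prodChar_add (η z w : Rm m × ℝ) : prodChar η (z + w) = prodChar η z * prodChar η w := by
  simp only [prodChar, ← Circle.coe_mul, ← AddChar.map_add_eq_mul]
  congr 2
  simp only [Prod.fst_add, Prod.snd_add, inner_add_left]
  ring

lemma fourierChar_eq_exp (x : ℝ) : (Real.fourierChar x : ℂ) =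
    Complex.exp (2 * Real.pi * x * Complex.I) := by
  rw [Real.fourierChar_apply]; push_cast; ring_nf

lemma prodChar_eq_one_of_mem {Γ : Submodule ℤ (Rm m × ℝ)} {η γ : Rm m × ℝ}
    (hη : η ∈ dualLattice Γ) (hγ : γ ∈ Γ) : prodChar η γ = 1 := by
  obtain ⟨n, hn⟩ := hη γ hγ
  rw [prodChar, hn, fourierChar_eq_exp, Complex.exp_eq_one_iff]
  exact ⟨-n, by push_cast; ring⟩

lemma prodChar_lattice_add {Γ : Submodule ℤ (Rm m × ℝ)} {η : Rm m × ℝ}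
    (hη : η ∈ dualLattice Γ) (γ : Γ) (z : Rm m × ℝ) : prodChar η (γ + z) = prodChar η z := by
  rw [prodChar_add, prodChar_eq_one_of_mem hη γ.2, one_mul]

lemma exists_prodChar_eq_neg_one {η : Rm m × ℝ} (hη : η ≠ 0) : ∃ w, prodChar η w = -1 := by
  set N := inner ℝ η.1 η.1 + η.2 * η.2 with hN
  have hN0 : N ≠ 0 := by
    intro h0
    have h1 : 0 ≤ inner ℝ η.1 η.1 := real_inner_self_nonneg
    have h2 : 0 ≤ η.2 * η.2 := mul_self_nonneg _
    refine hη (Prod.ext ?_ ?_)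
    · exact inner_self_eq_zero.1 (by linarith : inner ℝ η.1 η.1 = 0)
    · exact mul_self_eq_zero.1 (by linarith)
  refine ⟨(1 / (2 * N)) • η, ?_⟩
  have e : inner ℝ ((1 / (2 * N)) • η).1 η.1 + ((1 / (2 * N)) • η).2 * η.2 = 1 / 2 := by
    rw [Prod.smul_fst, Prod.smul_snd, real_inner_smul_left, smul_eq_mul, mul_assoc, ← mul_add,
      ← hN]
    field_simp
  rw [prodChar, e, fourierChar_eq_exp, show (2 * Real.pi * ((-(1 / 2) : ℝ) : ℂ) * Complex.I : ℂ)
    = -(Real.pi * Complex.I) by push_cast; ring, Complex.exp_neg, Complex.exp_pi_mul_I]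
  norm_num

lemma exists_inner_add_mul_eq (l : (Rm m × ℝ) →ₗ[ℝ] ℝ) :
    ∃ η : Rm m × ℝ, ∀ z : Rm m × ℝ, inner ℝ z.1 η.1 + z.2 * η.2 = l z := by
  refine ⟨((InnerProductSpace.toDual ℝ (Rm m)).symm
    (LinearMap.toContinuousLinearMap (l ∘ₗ LinearMap.inl ℝ _ _)), l (0, 1)), fun z => ?_⟩
  rw [real_inner_comm, InnerProductSpace.toDual_symm_apply]
  have : z = (z.1, 0) + z.2 • ((0, 1) : Rm m × ℝ) := by ext <;> simp
  conv_rhs => rw [this, map_add, map_smul, smul_eq_mul]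
  simp

variable {Γ : Submodule ℤ (Rm m × ℝ)} [DiscreteTopology Γ] [IsZLattice ℝ Γ]

lemma setIntegral_prodChar {F : Set (Rm m × ℝ)} (hF : IsAddFundamentalDomain Γ F volume)
    {η : Rm m × ℝ} (hη : η ∈ dualLattice Γ) :
    ∫ z in F, prodChar η z = ZLattice.covolume Γ volume * kroneckerZero η := by
  by_cases h0 : η = 0
  · subst h0
    rw [ZLattice.covolume_eq_measure_fundamentalDomain Γ volume hF]
    simp [prodChar, kroneckerZero]
  -- translating by a vector at which the character is `-1` changes the sign of the integral
  · obtain ⟨w, hw⟩ := exists_prodChar_eq_neg_one h0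
    have h1 := hF.setIntegral_eq (hF.vadd_of_comm w) (f := prodChar η) fun γ z =>
      prodChar_lattice_add hη γ z
    have h2 : ∫ z in w +ᵥ F, prodChar η z = ∫ z in F, prodChar η (w + z) :=
      (measurePreserving_add_left volume w).setIntegral_image_emb
        (measurableEmbedding_addLeft w) _ _
    rw [h2] at h1
    simp_rw [prodChar_add, hw, neg_one_mul] at h1
    rw [integral_neg, self_eq_neg] at h1
    simp [h1, kroneckerZero, h0]

/-- A function whose periodization is constant has Fourier transform supported, on the dual
lattice, at the origin. -/
lemma integral_prodChar_of_periodize_eq {P : Rm m × ℝ → ℝ≥0∞} (hP : Measurable P) {c : ℝ≥0∞}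
    (hc : c ≠ ∞) (h : ∀ᵐ z, periodize Γ P z = c) {η : Rm m × ℝ} (hη : η ∈ dualLattice Γ) :
    ∫ z, (P z).toReal • prodChar η z =
      c.toReal * ZLattice.covolume Γ volume * kroneckerZero η := by
  obtain ⟨F, hF, -, -, hvol, -⟩ := exists_fundamentalDomain Γ volume
  have hPint : ∫⁻ z, P z ≠ ∞ := by
    rw [← setLIntegral_periodize hF hP, lintegral_congr_ae (ae_restrict_of_ae h),
      setLIntegral_const, hvol]
    exact ENNReal.mul_ne_top hc ENNReal.ofReal_ne_top
  have hmeas : Measurable fun z => (P z).toReal • prodChar η z :=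
    hP.ennreal_toReal.smul (continuous_prodChar η).measurable
  have hint : Integrable (fun z => (P z).toReal • prodChar η z) := by
    refine (integrable_toReal_of_lintegral_ne_top hP.aemeasurable hPint).mono
      hmeas.aestronglyMeasurable (.of_forall fun z => ?_)
    rw [norm_smul, norm_prodChar, mul_one]
  rw [hF.integral_eq_tsum'' _ hint, ← integral_tsum]
  · have e : ∀ᵐ z ∂(volume.restrict F), ∑' γ : Γ, (P (γ +ᵥ z)).toReal • prodChar η (γ +ᵥ z)
        = c.toReal • prodChar η z := by
      filter_upwards [ae_restrict_of_ae h] with z hz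
      have hne : ∀ γ : Γ, P (γ + z) ≠ ∞ := fun γ =>
        ne_top_of_le_ne_top hc (hz ▸ ENNReal.le_tsum (f := fun γ : Γ => P (γ + z)) γ)
      have h1 : ∀ γ : Γ, (P (γ +ᵥ z)).toReal • prodChar η (γ +ᵥ z)
          = (((P (γ + z)).toReal : ℝ) : ℂ) * prodChar η z := fun γ => by
        rw [Submodule.vadd_def, vadd_eq_add, prodChar_lattice_add hη, Complex.real_smul]
      simp_rw [h1]
      rw [tsum_mul_right, ← Complex.ofReal_tsum, ← ENNReal.tsum_toReal_eq hne, Complex.real_smul]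
      congr 3
    rw [integral_congr_ae e, integral_smul, setIntegral_prodChar hF hη, Complex.real_smul,
      mul_assoc]
  · exact fun γ => (hmeas.comp (measurable_const_vadd γ)).aestronglyMeasurable
  · have e : ∀ (γ : Γ) (z : Rm m × ℝ), ‖(P (γ +ᵥ z)).toReal • prodChar η (γ +ᵥ z)‖ₑ
        ≤ P (γ +ᵥ z) := fun γ z => by
      rw [enorm_smul, ← ofReal_norm (prodChar η _), norm_prodChar, ENNReal.ofReal_one, mul_one,
        Real.enorm_eq_ofReal ENNReal.toReal_nonneg]
      exact ENNReal.ofReal_toReal_le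
    refine ne_top_of_le_ne_top hPint ?_
    rw [hF.lintegral_eq_tsum'' P]
    exact ENNReal.tsum_le_tsum fun γ => lintegral_mono fun z => e γ z

/-- A nonnegative integrable function whose Fourier transform vanishes on the dual lattice, except
at the origin, has a constant periodization: its image on the torus `(ℝ^m × ℝ) / Γ` is a measure
with the Fourier coefficients of a multiple of Haar measure. -/
lemma periodize_eq_of_integral_prodChar {P : Rm m × ℝ → ℝ≥0∞} (hP : Measurable P)
    (hPint : ∫⁻ z, P z ≠ ∞) {c : ℝ≥0∞} (hc : c ≠ ∞)
    (h : ∀ η ∈ dualLattice Γ, ∫ z, (P z).toReal • prodChar η z =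
      c.toReal * ZLattice.covolume Γ volume * kroneckerZero η) :
    ∀ᵐ z, periodize Γ P z = c := by
  obtain ⟨F, hF, hFm, -, hvol, -, hFinj⟩ := exists_fundamentalDomain Γ volume
  set b := Module.Free.chooseBasis ℤ Γ
  set B := b.ofZLatticeBasis ℝ with hB
  have hspan : Submodule.span ℤ (Set.range B) = Γ := b.ofZLatticeBasis_span ℝ
  set q : Rm m × ℝ → UnitAddTorus (Module.Free.ChooseBasisIndex ℤ Γ) :=
    fun z i => ((B.repr z i : ℝ) : UnitAddCircle) with hq
  have hcoord : ∀ i, Continuous fun z => B.repr z i := fun i =>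
    (LinearMap.continuous_of_finiteDimensional (B.coord i))
  have hqc : Continuous q := continuous_pi fun i => (AddCircle.continuous_mk' 1).comp (hcoord i)
  have hqm := hqc.measurable
  have hqper : ∀ (γ : Γ) z, q (γ + z) = q z := fun γ z => by
    ext i
    simp only [hq, map_add, Finsupp.add_apply, AddCircle.coe_add]
    rw [add_eq_right, AddCircle.coe_eq_zero_iff]
    exact ⟨b.repr γ i, by rw [hB, b.ofZLatticeBasis_repr_apply ℝ Γ γ i]; simp⟩
  have hqinj : Set.InjOn q F := fun z hz w hw hzw => by
    refine hFinj z hz w hw ?_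
    rw [← hspan, B.mem_span_iff_repr_mem ℤ]
    intro i
    have h1 : ((B.repr (z - w) i : ℝ) : UnitAddCircle) = 0 := by
      rw [map_sub, Finsupp.sub_apply, AddCircle.coe_sub, sub_eq_zero]
      exact congrFun hzw i
    obtain ⟨n, hn⟩ := (AddCircle.coe_eq_zero_iff _).1 h1
    exact ⟨n, by simpa using hn⟩
  -- the monomials of the torus are the characters given by the dual lattice
  have hmon : ∀ n, ∃ η ∈ dualLattice Γ, ∀ z, UnitAddTorus.mFourier n (q z) = prodChar η z := by
    intro n
    obtain ⟨η, hη⟩ := exists_inner_add_mul_eq (-∑ i, (n i : ℝ) • B.coord i)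
    have hη' : ∀ z : Rm m × ℝ, inner ℝ z.1 η.1 + z.2 * η.2 = -∑ i, (n i : ℝ) * B.repr z i :=
      fun z => by
        rw [hη]
        simp [LinearMap.neg_apply, LinearMap.sum_apply, LinearMap.smul_apply, Module.Basis.coord_apply]
    refine ⟨η, fun γ hγ => ⟨-∑ i, n i * b.repr ⟨γ, hγ⟩ i, ?_⟩, fun z => ?_⟩
    · rw [hη']
      push_cast
      congr 1
      refine Finset.sum_congr rfl fun i _ => ?_
      rw [hB, ← b.ofZLatticeBasis_repr_apply ℝ Γ ⟨γ, hγ⟩ i]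
    · rw [prodChar, hη', neg_neg, fourierChar_eq_exp]
      simp only [UnitAddTorus.mFourier, ContinuousMap.coe_mk, hq, fourier_coe_apply]
      rw [← Complex.exp_sum]
      congr 1
      push_cast
      rw [Finset.mul_sum, Finset.sum_mul]
      refine Finset.sum_congr rfl fun i _ => ?_
      ring
  set ν₁ := (volume.withDensity P).map q with hν₁
  set ν₂ := (c • volume.restrict F).map q with hν₂
  have : IsFiniteMeasure (volume.withDensity P) := isFiniteMeasure_withDensity hPint
  have : IsFiniteMeasure (volume.restrict F) :=
    ⟨by rw [Measure.restrict_apply_univ, hvol]; exact ENNReal.ofReal_lt_top⟩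
  have : IsFiniteMeasure (c • volume.restrict F) := Measure.smul_finite _ hc
  have hν : ν₁ = ν₂ := by
    refine measure_ext_of_integral_mFourier fun n => ?_
    obtain ⟨η, hη, hηq⟩ := hmon n
    rw [hν₁, hν₂, integral_map hqm.aemeasurable
      (UnitAddTorus.mFourier n).continuous.aestronglyMeasurable, integral_map hqm.aemeasurable
      (UnitAddTorus.mFourier n).continuous.aestronglyMeasurable]
    simp_rw [hηq]
    rw [integral_withDensity_eq_integral_toReal_smul hP (ae_lt_top hP hPint), h η hη,
      integral_smul_measure, setIntegral_prodChar hF hη, Complex.real_smul, mul_assoc]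
  -- equality on the torus, tested on images of subsets of the fundamental domain
  have hae : periodize Γ P =ᵐ[volume.restrict F] fun _ => c := by
    refine ae_eq_of_forall_setLIntegral_eq_of_sigmaFinite (measurable_periodize hP)
      measurable_const fun S hS _ => ?_
    rw [Measure.restrict_restrict hS]
    set S' := S ∩ F with hS'
    have hS'm : MeasurableSet S' := hS.inter hFm
    have hTm : MeasurableSet (q '' S') :=
      hS'm.image_of_measurable_injOn hqm (hqinj.mono Set.inter_subset_right)
    have hpre : q ⁻¹' (q '' S') ∩ F = S' := by
      ext z
      constructor
      · rintro ⟨⟨w, hw, hwz⟩, hz⟩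
        rwa [← hqinj hw.2 hz hwz]
      · exact fun hz => ⟨⟨z, hz, rfl⟩, hz.2⟩
    have hm : MeasurableSet (q ⁻¹' (q '' S')) := hqm hTm
    have h1 : ν₁ (q '' S') = ∫⁻ z in S', periodize Γ P z := by
      have e := setLIntegral_periodize_mul hF (h := (q ⁻¹' (q '' S')).indicator fun _ => 1) hP
        (measurable_const.indicator hm) fun z γ => by
          classical simp only [Set.indicator_apply, Set.mem_preimage, hqper]
      have hmul : ∀ (f : Rm m × ℝ → ℝ≥0∞) z, f z * (q ⁻¹' (q '' S')).indicator (fun _ => 1) z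
          = (q ⁻¹' (q '' S')).indicator f z := fun f z => by
        classical simp only [Set.indicator_apply, mul_ite, mul_one, mul_zero]
      simp_rw [hmul] at e
      rw [lintegral_indicator hm, lintegral_indicator hm, Measure.restrict_restrict hm, hpre] at e
      rw [hν₁, Measure.map_apply hqm hTm, withDensity_apply _ hm, e]
    have h2 : ν₂ (q '' S') = ∫⁻ _ in S', c := by
      rw [hν₂, Measure.map_apply hqm hTm, Measure.smul_apply, Measure.restrict_apply hm, hpre,
        setLIntegral_const, smul_eq_mul]
    rw [← h1, ← h2, hν]
  refine hF.measure_zero_of_invariant _ (fun γ => ?_) ?_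
  · ext z
    rw [Set.mem_vadd_set_iff_neg_vadd_mem, Submodule.vadd_def, vadd_eq_add, add_comm]
    simp only [Set.mem_compl_iff, Set.mem_ofPred_eq, periodize_add]
  · have := (ae_restrict_iff' hFm).1 hae
    rw [ae_iff] at this
    convert this using 2
    ext z
    simp [and_comm]

end Characters

/-! ### Translates of an interval, tight frames, and polarization -/

section Auxiliary

/-- If a measure on the line gives the same finite mass to the translates of an interval along a
dense set of translations, then it does so for every translate whose left endpoint is not an
atom. -/
lemma measure_Icc_eq_of_dense {ν : Measure ℝ} {a b : ℝ} (hab : a < b) {c : ℝ≥0∞} (hc : c ≠ ∞)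
    {S : Set ℝ} (hS : Dense S) (h : ∀ s ∈ S, ν (Set.Icc (a + s) (b + s)) = c) {s : ℝ}
    (hs : ν {a + s} = 0) : ν (Set.Icc (a + s) (b + s)) = c := by
  obtain ⟨u, hu, hmem, hlim⟩ := hS.exists_seq_strictAnti_tendsto s
  obtain ⟨s', hs', hsS⟩ := hS.exists_between (show s - (b - a) / 2 < s by linarith)
  refine le_antisymm ?_ ?_
  · have h1 : Tendsto (ν ∘ fun n => Set.Icc (a + u n) (b + s)) atTop
        (𝓝 (ν (⋃ n, Set.Icc (a + u n) (b + s)))) :=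
      tendsto_measure_iUnion_atTop fun i j hij =>
        Set.Icc_subset_Icc_left (by linarith [hu.antitone hij])
    have h2 : ν (⋃ n, Set.Icc (a + u n) (b + s)) ≤ c := le_of_tendsto h1 <| .of_forall fun n => by
      rw [← h _ (hmem n).2]
      exact measure_mono (Set.Icc_subset_Icc_right (by linarith [Set.mem_Ioi.1 (hmem n).1]))
    have h3 : Set.Icc (a + s) (b + s) ⊆ {a + s} ∪ ⋃ n, Set.Icc (a + u n) (b + s) := fun x hx => by
      rcases hx.1.eq_or_lt with h0 | h0
      · exact Or.inl h0.symm
      · obtain ⟨n, hn⟩ := (hlim.eventually_lt_const (show s < x - a by linarith)).exists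
        exact Or.inr (Set.mem_iUnion.2 ⟨n, by linarith, hx.2⟩)
    calc _ ≤ ν ({a + s} ∪ ⋃ n, Set.Icc (a + u n) (b + s)) := measure_mono h3
      _ ≤ ν {a + s} + ν (⋃ n, Set.Icc (a + u n) (b + s)) := measure_union_le _ _
      _ ≤ c := by rw [hs, zero_add]; exact h2
  · have hfin : ∃ n, ν (Set.Icc (a + s) (b + u n)) ≠ ∞ := by
      obtain ⟨n, hn⟩ := (hlim.eventually_lt_const
        (show s < s + (b - a) / 2 by linarith)).exists
      refine ⟨n, ne_top_of_le_ne_top (ENNReal.add_ne_top.2 ⟨hc, hc⟩)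
        ((measure_mono (fun x hx => ?_)).trans ((measure_union_le (Set.Icc (a + s') (b + s'))
          (Set.Icc (a + u n) (b + u n))).trans_eq (by rw [h _ hs', h _ (hmem n).2])))⟩
      rcases le_total x (b + s') with hx' | hx'
      · exact Or.inl ⟨by linarith [hx.1, hsS.2], hx'⟩
      · exact Or.inr ⟨by linarith [hsS.1], hx.2⟩
    have h1 : Tendsto (ν ∘ fun n => Set.Icc (a + s) (b + u n)) atTop
        (𝓝 (ν (⋂ n, Set.Icc (a + s) (b + u n)))) :=
      tendsto_measure_iInter_atTop (fun _ => measurableSet_Icc.nullMeasurableSet)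
        (fun i j hij => Set.Icc_subset_Icc_right (by linarith [hu.antitone hij])) hfin
    have h2 : c ≤ ν (⋂ n, Set.Icc (a + s) (b + u n)) := ge_of_tendsto h1 <| .of_forall fun n => by
      rw [← h _ (hmem n).2]
      exact measure_mono (Set.Icc_subset_Icc_left (by linarith [Set.mem_Ioi.1 (hmem n).1]))
    refine h2.trans (measure_mono fun x hx => ?_)
    rw [Set.mem_iInter] at hx
    exact ⟨(hx 0).1, ge_of_tendsto (hlim.const_add b) (.of_forall fun n => (hx n).2)⟩

lemma hasSum_sq_iff {ι : Type*} (f : ι → ℂ) {r : ℝ} (hr : 0 ≤ r) :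
    HasSum (fun i => ‖f i‖ ^ 2) r ↔ ∑' i, ‖f i‖ₑ ^ 2 = ENNReal.ofReal r := by
  have e : ∀ i, ‖f i‖ₑ ^ 2 = ENNReal.ofReal (‖f i‖ ^ 2) := fun i => by
    rw [← ofReal_norm, ENNReal.ofReal_pow (norm_nonneg _)]
  simp_rw [e]
  constructor
  · intro h
    rw [← ENNReal.ofReal_tsum_of_nonneg (fun _ => by positivity) h.summable, h.tsum_eq]
  · intro h
    have h1 := ENNReal.hasSum_toReal (h ▸ ENNReal.ofReal_ne_top)
    rw [← ENNReal.tsum_toReal_eq (fun _ => ENNReal.ofReal_ne_top), h, ENNReal.toReal_ofReal hr] at h1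
    simpa [ENNReal.toReal_ofReal] using h1

/-- It suffices to check the normalized tight frame identity on a dense set. -/
lemma isNormalizedTightFrame_of_dense {ι H : Type*} [NormedAddCommGroup H] [InnerProductSpace ℂ H]
    {φ : ι → H} {S : Set H} (hS : Dense S)
    (h : ∀ f ∈ S, HasSum (fun i => ‖inner ℂ (φ i) f‖ ^ 2) (‖f‖ ^ 2)) :
    IsNormalizedTightFrame φ := by
  have hfin : ∀ (s : Finset ι) (f : H), ∑ i ∈ s, ‖inner ℂ (φ i) f‖ ^ 2 ≤ ‖f‖ ^ 2 := fun s f => by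
    have hcl : IsClosed {f : H | ∑ i ∈ s, ‖inner ℂ (φ i) f‖ ^ 2 ≤ ‖f‖ ^ 2} :=
      isClosed_le (by fun_prop) (by fun_prop)
    have : S ⊆ {f : H | ∑ i ∈ s, ‖inner ℂ (φ i) f‖ ^ 2 ≤ ‖f‖ ^ 2} := fun f hf =>
      sum_le_hasSum s (fun _ _ => by positivity) (h f hf)
    exact hcl.closure_subset_iff.2 this (hS f)
  have hsum : ∀ f : H, Summable fun i => ‖inner ℂ (φ i) f‖ ^ 2 := fun f =>
    summable_of_sum_le (fun _ => by positivity) (hfin · f)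
  have hle : ∀ f : H, ∑' i, ‖inner ℂ (φ i) f‖ ^ 2 ≤ ‖f‖ ^ 2 := fun f =>
    (hsum f).tsum_le_of_sum_le (hfin · f)
  -- the lower bound, from `|a + b|² ≤ (1 + δ) |a|² + (1 + 1/δ) |b|²`
  have hge : ∀ f : H, ∀ δ > 0, ‖f‖ ^ 2 ≤ (1 + δ) * ∑' i, ‖inner ℂ (φ i) f‖ ^ 2 := by
    intro f δ hδ
    set Q := ∑' i, ‖inner ℂ (φ i) f‖ ^ 2
    have hcl : IsClosed {f' : H | ‖f'‖ ^ 2 ≤ (1 + δ) * Q + (1 + 1 / δ) * ‖f' - f‖ ^ 2} :=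
      isClosed_le (by fun_prop) (by fun_prop)
    have hsub : S ⊆ {f' : H | ‖f'‖ ^ 2 ≤ (1 + δ) * Q + (1 + 1 / δ) * ‖f' - f‖ ^ 2} := fun f' hf' => by
      have hpt : ∀ i, ‖inner ℂ (φ i) f'‖ ^ 2 ≤ (1 + δ) * ‖inner ℂ (φ i) f‖ ^ 2
          + (1 + 1 / δ) * ‖inner ℂ (φ i) (f' - f)‖ ^ 2 := fun i => by
        have h1 : ‖inner ℂ (φ i) f'‖ ≤ ‖inner ℂ (φ i) f‖ + ‖inner ℂ (φ i) (f' - f)‖ := by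
          rw [inner_sub_right]
          calc _ = ‖inner ℂ (φ i) f + (inner ℂ (φ i) f' - inner ℂ (φ i) f)‖ := by congr 1; ring
            _ ≤ _ := norm_add_le _ _
        set A := ‖inner ℂ (φ i) f‖
        set B := ‖inner ℂ (φ i) (f' - f)‖
        have h2 : (A + B) ^ 2 ≤ (1 + δ) * A ^ 2 + (1 + 1 / δ) * B ^ 2 := by
          have : (1 + δ) * A ^ 2 + (1 + 1 / δ) * B ^ 2 - (A + B) ^ 2 = (δ * A - B) ^ 2 / δ := by
            field_simp; ring
          have h3 : 0 ≤ (δ * A - B) ^ 2 / δ := by positivity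
          linarith
        exact (pow_le_pow_left₀ (norm_nonneg _) h1 2).trans h2
      rw [Set.mem_ofPred_eq, ← (h f' hf').tsum_eq]
      calc _ ≤ ∑' i, ((1 + δ) * ‖inner ℂ (φ i) f‖ ^ 2
            + (1 + 1 / δ) * ‖inner ℂ (φ i) (f' - f)‖ ^ 2) :=
            (hsum f').tsum_le_tsum hpt (((hsum f).mul_left _).add ((hsum _).mul_left _))
        _ = (1 + δ) * Q + (1 + 1 / δ) * ∑' i, ‖inner ℂ (φ i) (f' - f)‖ ^ 2 := by
            rw [((hsum f).mul_left _).tsum_add ((hsum _).mul_left _), tsum_mul_left, tsum_mul_left]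
        _ ≤ _ := by gcongr; exact hle _
    have := hcl.closure_subset_iff.2 hsub (hS f)
    simpa using this
  intro f
  have heq : ∑' i, ‖inner ℂ (φ i) f‖ ^ 2 = ‖f‖ ^ 2 := by
    refine le_antisymm (hle f) ?_
    have hlim : Tendsto (fun δ : ℝ => (1 + δ) * ∑' i, ‖inner ℂ (φ i) f‖ ^ 2) (𝓝[>] 0)
        (𝓝 ((1 + 0) * ∑' i, ‖inner ℂ (φ i) f‖ ^ 2)) :=
      ((tendsto_const_nhds.add tendsto_id).mul_const _).mono_left nhdsWithin_le_nhds
    rw [add_zero, one_mul] at hlim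
    exact ge_of_tendsto hlim (eventually_mem_nhdsWithin.mono fun δ hδ => hge f δ hδ)
  rw [← heq]
  exact (hsum f).hasSum

lemma lintegral_enorm_sq {α : Type*} [MeasurableSpace α] {μ : Measure α} (f : α → ℂ) :
    ∫⁻ x, ‖f x‖ₑ ^ 2 ∂μ = eLpNorm f 2 μ ^ 2 := by
  have := eLpNorm_nnreal_pow_eq_lintegral (f := f) (μ := μ) (p := 2) (by norm_num)
  simpa using this.symm

lemma lintegral_enorm_sq_Lp {α : Type*} [MeasurableSpace α] {μ : Measure α} (f : Lp ℂ 2 μ) :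
    ∫⁻ x, ‖f x‖ₑ ^ 2 ∂μ = ENNReal.ofReal (‖f‖ ^ 2) := by
  rw [lintegral_enorm_sq, Lp.norm_def, ← ENNReal.toReal_pow, ENNReal.ofReal_toReal]
  exact ENNReal.pow_ne_top (Lp.eLpNorm_ne_top f)

/-- The amalgam space `W(L², ℓ¹)` is contained in `L¹`. -/
lemma MemWiener.integrable {m : ℕ} {f : Rm m → ℂ} (hf : MemWiener 2 1 f) : Integrable f := by
  refine ⟨hf.1, ?_⟩
  have hcube : ∀ k : Fin m → ℤ, unitCube k = cube (WithLp.toLp 2 fun i => (k i : ℝ)) 1 :=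
    fun k => rfl
  have hmeas : ∀ k : Fin m → ℤ, MeasurableSet (unitCube k) := fun k => by
    rw [hcube]; exact measurableSet_cube _ _
  have hcov : ⋃ k : Fin m → ℤ, unitCube k = Set.univ := by
    refine Set.eq_univ_of_forall fun x => Set.mem_iUnion.2 ⟨fun i => ⌊x i⌋, fun i => ?_⟩
    exact ⟨Int.floor_le _, (Int.lt_floor_add_one _).le⟩
  have hW := hf.2
  rw [wienerNorm, eLpNorm_one_eq_lintegral_enorm, lintegral_count] at hW
  rw [hasFiniteIntegral_iff_enorm, ← setLIntegral_univ, ← hcov]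
  refine (lintegral_iUnion_le _ _).trans_lt (lt_of_le_of_lt (ENNReal.tsum_le_tsum fun k => ?_) hW)
  have h1 := eLpNorm_le_eLpNorm_mul_rpow_measure_univ (p := 1) (q := 2) (by norm_num)
    (hf.1.restrict (s := unitCube k))
  rw [Measure.restrict_apply_univ, hcube, volume_cube _ zero_le_one, ← hcube] at h1
  rw [← eLpNorm_one_eq_lintegral_enorm, eLpNorm_indicator_eq_eLpNorm_restrict (hmeas k)]
  simpa using h1

/-- Polarization: a bounded function `M` is determined by the quadratic form
`u ↦ ∫ M(t) u(t) conj (u(t - a)) dt` on `L²`. -/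
lemma ae_eq_zero_of_quadratic_form {E : Type*} [NormedAddCommGroup E] [MeasurableSpace E]
    [BorelSpace E] {μ : Measure E} [SigmaFinite μ] [μ.IsAddRightInvariant] {M : E → ℂ}
    (hM : AEStronglyMeasurable M μ) {C : ℝ} (hC : ∀ᵐ t ∂μ, ‖M t‖ ≤ C) (a : E)
    (h : ∀ u : E → ℂ, MemLp u 2 μ →
      ∫ t, M t * (u t * (starRingEnd ℂ) (u (t - a))) ∂μ = 0) : M =ᵐ[μ] 0 := by
  have hconj : ∀ v : E → ℂ, MemLp v 2 μ → MemLp (fun t => (starRingEnd ℂ) (v (t - a))) 2 μ :=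
    fun v hv => by
      have h1 := (hv.comp_measurePreserving (measurePreserving_sub_right μ a)).star
      exact h1
  have hint : ∀ u v : E → ℂ, MemLp u 2 μ → MemLp v 2 μ →
      Integrable (fun t => M t * (u t * (starRingEnd ℂ) (v (t - a)))) μ := fun u v hu hv =>
    (hu.integrable_mul (hconj v hv)).bdd_mul hM hC
  set Q : (E → ℂ) → (E → ℂ) → ℂ := fun u v =>
    ∫ t, M t * (u t * (starRingEnd ℂ) (v (t - a))) ∂μ with hQ
  have hadd : ∀ (u v : E → ℂ), MemLp u 2 μ → MemLp v 2 μ → ∀ c : ℂ,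
      (starRingEnd ℂ) c * Q u v + c * Q v u = 0 := fun u v hu hv c => by
    have hcv : MemLp (fun t => c * v t) 2 μ := hv.const_mul c
    have h0 := h (fun t => u t + c * v t) (hu.add hcv)
    have e : ∀ t, M t * ((u t + c * v t) * (starRingEnd ℂ) (u (t - a) + c * v (t - a)))
        = M t * (u t * (starRingEnd ℂ) (u (t - a)))
          + (starRingEnd ℂ) c * (M t * (u t * (starRingEnd ℂ) (v (t - a))))
          + (c * (M t * (v t * (starRingEnd ℂ) (u (t - a))))
          + c * (starRingEnd ℂ) c * (M t * (v t * (starRingEnd ℂ) (v (t - a))))) := fun t => by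
      rw [map_add, map_mul]; ring
    simp_rw [e] at h0
    have i₁ : Integrable (fun t => M t * (u t * (starRingEnd ℂ) (u (t - a)))
        + (starRingEnd ℂ) c * (M t * (u t * (starRingEnd ℂ) (v (t - a))))) μ :=
      (hint u u hu hu).add ((hint u v hu hv).const_mul _)
    have i₂ : Integrable (fun t => c * (M t * (v t * (starRingEnd ℂ) (u (t - a))))
        + c * (starRingEnd ℂ) c * (M t * (v t * (starRingEnd ℂ) (v (t - a))))) μ :=
      ((hint v u hv hu).const_mul _).add ((hint v v hv hv).const_mul _)
    rw [integral_add i₁ i₂,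
      integral_add (hint u u hu hu) ((hint u v hu hv).const_mul _),
      integral_add ((hint v u hv hu).const_mul _) ((hint v v hv hv).const_mul _),
      integral_const_mul, integral_const_mul, integral_const_mul, h u hu, h v hv] at h0
    simpa using h0
  have hQ0 : ∀ u v : E → ℂ, MemLp u 2 μ → MemLp v 2 μ → Q u v = 0 := fun u v hu hv => by
    have h1 := hadd u v hu hv 1
    have hI := hadd u v hu hv Complex.I
    simp only [map_one, one_mul, Complex.conj_I] at h1 hI
    have h2 : Complex.I * (2 * Q u v) = 0 := by linear_combination Complex.I * h1 - hI
    simpa using h2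
  refine ae_eq_zero_of_forall_setIntegral_eq_of_sigmaFinite (fun s hs hμs => ?_) fun s hs hμs => ?_
  · exact Measure.integrableOn_of_bounded hμs.ne hM (ae_restrict_of_ae hC)
  · set u : E → ℂ := s.indicator fun _ => 1 with hu
    have hum : MemLp u 2 μ := memLp_indicator_const 2 hs _ (Or.inr hμs.ne)
    have hvm : MemLp (fun t => u (t + a)) 2 μ :=
      hum.comp_measurePreserving (measurePreserving_add_right μ a)
    have := hQ0 u _ hum hvm
    rw [← integral_indicator hs, ← this, hQ]
    refine integral_congr_ae (.of_forall fun t => ?_)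
    by_cases ht : t ∈ s
    · simp [hu, ht]
    · simp [hu, ht]

end Auxiliary

/-! ### Frame sums as periodizations -/

section Translates

variable {m : ℕ}

lemma translateL2_coeFn (a : Rm m) (f : L2 m) :
    translateL2 a f =ᵐ[volume] fun t => f (t - a) :=
  Lp.coeFn_compMeasurePreserving f (measurePreserving_sub_right volume a)

lemma inner_translateL2_translateL2 (x y : Rm m) (g f : L2 m) :
    inner ℂ (translateL2 y g) (translateL2 x f) = inner ℂ (translateL2 (y - x) g) f := by
  rw [L2.inner_def, L2.inner_def, ← integral_sub_right_eq_self
    (fun t => inner ℂ ((translateL2 (y - x) g : L2 m) t) ((f : L2 m) t)) x]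
  refine integral_congr_ae ?_
  have h1 := (measurePreserving_sub_right volume x).quasiMeasurePreserving.ae
    (translateL2_coeFn (y - x) g)
  filter_upwards [translateL2_coeFn y g, translateL2_coeFn x f, h1] with t h1 h2 h3
  rw [h1, h2, h3, sub_sub_sub_cancel_right]

lemma norm_translateL2 (x : Rm m) (f : L2 m) : ‖translateL2 x f‖ = ‖f‖ :=
  Lp.norm_compMeasurePreserving f (measurePreserving_sub_right volume x)

lemma translateL2_zero (f : L2 m) : translateL2 0 f = f := by
  refine Lp.ext ?_
  filter_upwards [translateL2_coeFn 0 f] with t ht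
  rw [ht, sub_zero]

lemma continuous_translateL2 (f : L2 m) : Continuous fun x : Rm m => translateL2 x f := by
  set F : Rm m → C(Rm m, Rm m) := fun x => ⟨fun t => t - x, by fun_prop⟩ with hF
  have hFc : Continuous F := by
    refine ContinuousMap.continuous_of_continuous_uncurry _ ?_
    change Continuous fun p : Rm m × Rm m => p.2 - p.1
    fun_prop
  exact Continuous.compMeasurePreservingLp continuous_const hFc
    (fun x => measurePreserving_sub_right volume x) (by norm_num)

/-- The product `ĝ · conj f̂`, whose Fourier transform gives the conjugates of the inner products
of `f` with the translates of `g`. -/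
noncomputable def crossSpectrum (g f : L2 m) (t : Rm m) : ℂ :=
  𝓕 (fun x => g x) t * (starRingEnd ℂ) ((𝓕 f : L2 m) t)

lemma memLp_two_fourier_coeFn {g : L2 m} (hg : Integrable (fun x => g x)) :
    MemLp (𝓕 (fun x => g x)) 2 volume :=
  memLp_two_fourier hg (Lp.memLp g)

lemma memLp_two_conj_fourier (f : L2 m) :
    MemLp (fun t => (starRingEnd ℂ) ((𝓕 f : L2 m) t)) 2 volume :=
  (Lp.memLp (𝓕 f : L2 m)).star

lemma integrable_crossSpectrum {g : L2 m} (hg : Integrable (fun x => g x)) (f : L2 m) :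
    Integrable (crossSpectrum g f) :=
  (memLp_two_fourier_coeFn hg).integrable_mul (memLp_two_conj_fourier f)

lemma memLp_two_crossSpectrum {g : L2 m} (hg : Integrable (fun x => g x)) (f : L2 m) :
    MemLp (crossSpectrum g f) 2 := by
  refine (memLp_two_conj_fourier f).of_le_mul (c := ∫ x, ‖g x‖)
    (integrable_crossSpectrum hg f).aestronglyMeasurable (.of_forall fun t => ?_)
  rw [crossSpectrum, norm_mul]
  gcongr
  exact norm_fourier_le _ _

lemma conj_inner_translateL2 {g : L2 m} (hg : Integrable (fun x => g x)) (f : L2 m) (y : Rm m) :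
    (starRingEnd ℂ) (inner ℂ (translateL2 y g) f) = 𝓕 (crossSpectrum g f) y := by
  have hgy : Integrable (fun t => g (t - y)) := hg.comp_sub_right y
  have hgy2 : MemLp (fun t => g (t - y)) 2 volume :=
    (Lp.memLp g).comp_measurePreserving (measurePreserving_sub_right volume y)
  have e1 : translateL2 y g = hgy2.toLp _ := by
    refine Lp.ext ?_
    filter_upwards [translateL2_coeFn y g, hgy2.coeFn_toLp] with t h1 h2
    rw [h1, h2]
  rw [inner_conj_symm, ← Lp.inner_fourier_eq, L2.inner_def, Real.fourier_eq]
  refine integral_congr_ae ?_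
  have h1 := fourier_toLp_ae_eq hgy hgy2
  rw [← e1] at h1
  filter_upwards [h1] with t ht
  rw [ht, fourier_comp_sub_right (fun t => g t) y t, RCLike.inner_apply, crossSpectrum,
    Circle.smul_def, smul_eq_mul, real_inner_comm]
  ring

lemma enorm_inner_translateL2 {g : L2 m} (hg : Integrable (fun x => g x)) (f : L2 m) (y : Rm m) :
    ‖inner ℂ (translateL2 y g) f‖ₑ = ‖𝓕 (crossSpectrum g f) y‖ₑ := by
  rw [← conj_inner_translateL2 hg, ← ofReal_norm, ← ofReal_norm, RCLike.norm_conj]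

variable {K : Type*}

/-- The sum over `k` of the squared inner products of `f` with the translates of the `g k` by
`y`. -/
noncomputable def translateEnergy (g : K → L2 m) (f : L2 m) (y : Rm m) : ℝ≥0∞ :=
  ∑' k, ‖inner ℂ (translateL2 y (g k)) f‖ₑ ^ 2

/-- The function on `ℝ^m × ℝ` whose periodization describes the frame sums of all translates of
`f` and of all translates of the window. -/
noncomputable def windowedEnergy (g : K → L2 m) (Ω : Set ℝ) (f : L2 m) (z : Rm m × ℝ) : ℝ≥0∞ :=
  translateEnergy g f z.1 * Ω.indicator (fun _ => 1) z.2

lemma measurable_enorm_inner {g : L2 m} (hg : Integrable (fun x => g x)) (f : L2 m) :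
    Measurable fun y => ‖inner ℂ (translateL2 y g) f‖ₑ ^ 2 := by
  simp_rw [enorm_inner_translateL2 hg]
  exact ((continuous_fourier (integrable_crossSpectrum hg f)).measurable.enorm).pow_const 2

lemma measurable_translateEnergy [Countable K] {g : K → L2 m}
    (hg : ∀ k, Integrable (fun x => g k x)) (f : L2 m) : Measurable (translateEnergy g f) :=
  Measurable.tsum fun k => measurable_enorm_inner (hg k) f

lemma measurable_windowedEnergy [Countable K] {g : K → L2 m}
    (hg : ∀ k, Integrable (fun x => g k x)) {Ω : Set ℝ} (hΩ : MeasurableSet Ω) (f : L2 m) :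
    Measurable (windowedEnergy g Ω f) :=
  ((measurable_translateEnergy hg f).comp measurable_fst).mul
    ((measurable_const.indicator hΩ).comp measurable_snd)

lemma translateEnergy_translateL2 (g : K → L2 m) (f : L2 m) (x y : Rm m) :
    translateEnergy g (translateL2 x f) y = translateEnergy g f (y - x) := by
  simp only [translateEnergy, inner_translateL2_translateL2]

variable {Γ : Submodule ℤ (Rm m × ℝ)}

lemma tsum_modelSet (hΓ : Set.InjOn Prod.fst (Γ : Set (Rm m × ℝ))) (Ω : Set ℝ)
    (w : Rm m → ℝ≥0∞) : ∑' x : modelSet Γ Ω, w x =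
      ∑' γ : Γ, w (γ : Rm m × ℝ).1 * Ω.indicator (fun _ => 1) (γ : Rm m × ℝ).2 := by
  have h1 : modelSet Γ Ω = Prod.fst '' ((Γ : Set (Rm m × ℝ)) ∩ Prod.snd ⁻¹' Ω) := by
    ext x
    constructor
    · rintro ⟨γ, hγ, rfl, h2⟩
      exact ⟨γ, ⟨hγ, h2⟩, rfl⟩
    · rintro ⟨γ, ⟨hγ, h2⟩, rfl⟩
      exact ⟨γ, hγ, rfl, h2⟩
  rw [h1, tsum_image _ (hΓ.mono Set.inter_subset_left)]
  refine (tsum_subtype ((Γ : Set (Rm m × ℝ)) ∩ Prod.snd ⁻¹' Ω)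
    fun z : Rm m × ℝ => w z.1).trans ?_
  refine Eq.trans ?_ (tsum_subtype (Γ : Set (Rm m × ℝ))
    fun z : Rm m × ℝ => w z.1 * Ω.indicator (fun _ => 1) z.2).symm
  refine tsum_congr fun z => ?_
  rw [← Set.indicator_indicator]
  congr 1
  ext z
  by_cases hz : z.2 ∈ Ω
  · simp [hz]
  · simp [hz]

/-- The frame sum of `f` as a value of a periodization. -/
lemma tsum_frame_eq_periodize (hΓ : Set.InjOn Prod.fst (Γ : Set (Rm m × ℝ))) (g : K → L2 m)
    (Ω : Set ℝ) (f : L2 m) :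
    ∑' i : K × modelSet Γ Ω, ‖inner ℂ (translateL2 (i.2 : Rm m) (g i.1)) f‖ₑ ^ 2 =
      periodize Γ (windowedEnergy g Ω f) 0 := by
  rw [ENNReal.tsum_prod (f := fun k (x : modelSet Γ Ω) =>
    ‖inner ℂ (translateL2 (x : Rm m) (g k)) f‖ₑ ^ 2), ENNReal.tsum_comm]
  refine (tsum_modelSet hΓ Ω (translateEnergy g f)).trans ?_
  simp [periodize, windowedEnergy]

lemma periodize_windowedEnergy_fst (g : K → L2 m) (Ω : Set ℝ) (f : L2 m) (x : Rm m) :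
    periodize Γ (windowedEnergy g Ω f) (x, 0) =
      periodize Γ (windowedEnergy g Ω (translateL2 (-x) f)) 0 := by
  simp [periodize, windowedEnergy, translateEnergy_translateL2]

lemma isNormalizedTightFrame_iff_periodize (hΓ : Set.InjOn Prod.fst (Γ : Set (Rm m × ℝ)))
    (g : K → L2 m) (Ω : Set ℝ) :
    IsNormalizedTightFrame (fun i : K × modelSet Γ Ω => translateL2 (i.2 : Rm m) (g i.1)) ↔
      ∀ f : L2 m, periodize Γ (windowedEnergy g Ω f) 0 = ENNReal.ofReal (‖f‖ ^ 2) := by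
  refine forall_congr' fun f => ?_
  rw [hasSum_sq_iff _ (by positivity), tsum_frame_eq_periodize hΓ]

/-- For fixed `x`, the values at `(x, s)` of the periodization are the masses of translates of the
window under a measure carried by `p₂(Γ)`. -/
lemma exists_measure_periodize_windowedEnergy [Countable Γ] (g : K → L2 m) (a b : ℝ)
    (f : L2 m) (x : Rm m) : ∃ ν : Measure ℝ,
      (∀ s, periodize Γ (windowedEnergy g (Set.Icc a b) f) (x, s)
        = ν (Set.Icc (a + -s) (b + -s))) ∧
      ∀ s, s ∉ Prod.snd '' (Γ : Set (Rm m × ℝ)) → ν {s} = 0 := by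
  refine ⟨Measure.sum fun γ : Γ => translateEnergy g f ((γ : Rm m × ℝ).1 + x) •
    Measure.dirac (γ : Rm m × ℝ).2, fun s => ?_, fun s hs => ?_⟩
  · rw [Measure.sum_apply _ measurableSet_Icc, periodize]
    refine tsum_congr fun γ => ?_
    rw [Measure.smul_apply, Measure.dirac_apply' _ measurableSet_Icc, smul_eq_mul, windowedEnergy]
    congr 1
    refine le_antisymm (indicator_one_le fun h => ?_) (indicator_one_le fun h => ?_)
    · simp only [Prod.snd_add, Set.mem_Icc] at h ⊢
      constructor <;> linarith [h.1, h.2]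
    · simp only [Prod.snd_add, Set.mem_Icc] at h ⊢
      constructor <;> linarith [h.1, h.2]
  · rw [Measure.sum_apply _ (measurableSet_singleton s), ENNReal.tsum_eq_zero]
    intro γ
    rw [Measure.smul_apply, Measure.dirac_apply' _ (measurableSet_singleton s),
      Set.indicator_of_notMem, smul_zero]
    exact fun h => hs ⟨γ, γ.2, h⟩

variable [DiscreteTopology Γ] [IsZLattice ℝ Γ]

lemma dense_neg_preimage {S : Set ℝ} (hS : Dense S) : Dense {s : ℝ | -s ∈ S} :=
  hS.preimage (Homeomorph.neg ℝ).isOpenMap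

/-- The tight frame identity at the point `0` of the torus `(ℝ^m × ℝ) / Γ` is equivalent to the
same identity almost everywhere on the torus. -/
lemma isNormalizedTightFrame_iff_ae (hΓ : IsCutAndProject Γ) (g : K → L2 m) {a b : ℝ} (hab : a < b)
    (ha : a ∉ Prod.snd '' (Γ : Set (Rm m × ℝ))) :
    IsNormalizedTightFrame
        (fun i : K × modelSet Γ (Set.Icc a b) => translateL2 (i.2 : Rm m) (g i.1)) ↔
      ∀ f : L2 m, ∀ᵐ z : Rm m × ℝ,
        periodize Γ (windowedEnergy g (Set.Icc a b) f) z = ENNReal.ofReal (‖f‖ ^ 2) := by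
  have hcount : (Prod.snd '' (Γ : Set (Rm m × ℝ))).Countable :=
    (Set.countable_coe_iff.1 (inferInstance : Countable Γ)).image _
  constructor
  · rw [isNormalizedTightFrame_iff_periodize hΓ.injOn_fst]
    intro h f
    -- lattice translations give the identity for all second coordinates in `p₂(Γ)`
    have hlat : ∀ (x : Rm m), ∀ γ ∈ Γ, periodize Γ (windowedEnergy g (Set.Icc a b) f) (x, γ.2)
        = ENNReal.ofReal (‖f‖ ^ 2) := fun x γ hγ => by
      have e : ((x, γ.2) : Rm m × ℝ) = (x - γ.1, 0) + ((⟨γ, hγ⟩ : Γ) : Rm m × ℝ) := by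
        ext <;> simp
      rw [e, periodize_add, periodize_windowedEnergy_fst, h, norm_translateL2]
    have hae : ∀ᵐ z : Rm m × ℝ, z.2 ∉ (fun s => a + -s) ⁻¹' (Prod.snd '' (Γ : Set (Rm m × ℝ))) := by
      rw [Measure.volume_eq_prod]
      refine Measure.quasiMeasurePreserving_snd.ae (measure_eq_zero_iff_ae_notMem.1 ?_)
      refine Set.Countable.measure_zero ?_ _
      exact hcount.preimage_of_injOn fun s _ t _ hst => by simpa using hst
    filter_upwards [hae] with z hz
    obtain ⟨ν, hν, hν0⟩ := exists_measure_periodize_windowedEnergy (Γ := Γ) g a b f z.1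
    rw [show z = (z.1, z.2) from rfl, hν]
    refine measure_Icc_eq_of_dense hab ENNReal.ofReal_ne_top (dense_neg_preimage hΓ.dense_snd)
      (fun s hs => ?_) (hν0 _ hz)
    obtain ⟨γ, hγ, hγs⟩ := hs
    have := hlat z.1 γ hγ
    rwa [hν, hγs, neg_neg] at this
  · intro h
    have hae : ∀ f : L2 m, ∀ᵐ x : Rm m,
        periodize Γ (windowedEnergy g (Set.Icc a b) (translateL2 (-x) f)) 0
          = ENNReal.ofReal (‖translateL2 (-x) f‖ ^ 2) := fun f => by
      have hf := h f
      rw [Measure.volume_eq_prod] at hf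
      filter_upwards [Measure.ae_ae_of_ae_prod hf] with x hx
      obtain ⟨ν, hν, hν0⟩ := exists_measure_periodize_windowedEnergy (Γ := Γ) g a b f x
      rw [← periodize_windowedEnergy_fst, norm_translateL2, hν, neg_zero]
      refine measure_Icc_eq_of_dense hab ENNReal.ofReal_ne_top
        (dense_neg_preimage (Measure.dense_of_ae hx)) (fun s hs => ?_)
        (hν0 _ (by simpa using ha))
      have := hs.out
      rwa [Set.mem_ofPred_eq, hν, neg_neg] at this
    refine isNormalizedTightFrame_of_dense (S := {f : L2 m |
      periodize Γ (windowedEnergy g (Set.Icc a b) f) 0 = ENNReal.ofReal (‖f‖ ^ 2)}) ?_ fun f hf => ?_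
    · intro f
      have hd := Measure.dense_of_ae (hae f)
      have hc : Continuous fun x : Rm m => translateL2 (-x) f :=
        (continuous_translateL2 f).comp continuous_neg
      have h0 : translateL2 (-0) f = f := by rw [neg_zero, translateL2_zero]
      have := image_closure_subset_closure_image hc ⟨0, hd 0, h0⟩
      refine closure_mono ?_ this
      rintro _ ⟨x, hx, rfl⟩
      exact hx
    · rw [hasSum_sq_iff _ (by positivity), tsum_frame_eq_periodize hΓ.injOn_fst]
      exact hf

end Translates

/-! ### Fourier transform of the windowed energy -/

section Spectrum

variable {m : ℕ} {K : Type*} [Countable K]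

lemma lintegral_enorm_fourier_sq {f : Rm m → ℂ} (hf : Integrable f) (hf2 : MemLp f 2) :
    ∫⁻ y, ‖𝓕 f y‖ₑ ^ 2 = ∫⁻ t, ‖f t‖ₑ ^ 2 := by
  have h1 := Lp.norm_fourier_eq (hf2.toLp f)
  rw [Lp.norm_toLp, Lp.norm_def, ENNReal.toReal_eq_toReal_iff' (Lp.eLpNorm_ne_top _) hf2.eLpNorm_ne_top,
    eLpNorm_congr_ae (fourier_toLp_ae_eq hf hf2)] at h1
  rw [lintegral_enorm_sq, lintegral_enorm_sq, h1]

lemma measurable_fourier_coeFn {g : L2 m} (hg : Integrable (fun x => g x)) :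
    Measurable (𝓕 (fun x => g x)) :=
  (continuous_fourier hg).measurable

lemma lintegral_enorm_fourier_crossSpectrum {g : L2 m} (hg : Integrable (fun x => g x)) (f : L2 m) :
    ∫⁻ y, ‖𝓕 (crossSpectrum g f) y‖ₑ ^ 2
      = ∫⁻ t, ‖𝓕 (fun x => g x) t‖ₑ ^ 2 * ‖(𝓕 f : L2 m) t‖ₑ ^ 2 := by
  rw [lintegral_enorm_fourier_sq (integrable_crossSpectrum hg f) (memLp_two_crossSpectrum hg f)]
  refine lintegral_congr fun t => ?_
  rw [crossSpectrum, enorm_mul, mul_pow]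
  congr 2
  rw [← ofReal_norm, RCLike.norm_conj, ofReal_norm]

lemma lintegral_translateEnergy {g : K → L2 m} (hg : ∀ k, Integrable (fun x => g k x)) (f : L2 m) :
    ∫⁻ y, translateEnergy g f y
      = ∫⁻ t, (∑' k, ‖𝓕 (fun x => g k x) t‖ₑ ^ 2) * ‖(𝓕 f : L2 m) t‖ₑ ^ 2 := by
  have hmeas : AEMeasurable (fun t => ‖(𝓕 f : L2 m) t‖ₑ ^ 2) (volume : Measure (Rm m)) :=
    (Lp.aestronglyMeasurable _).enorm.pow_const 2
  have hprod : ∀ k, AEMeasurable (fun t => ‖𝓕 (fun x => g k x) t‖ₑ ^ 2 * ‖(𝓕 f : L2 m) t‖ₑ ^ 2)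
      (volume : Measure (Rm m)) := fun k =>
    ((measurable_fourier_coeFn (hg k)).enorm.pow_const 2).aemeasurable.mul hmeas
  simp only [translateEnergy, ← ENNReal.tsum_mul_right]
  rw [lintegral_tsum fun k => (measurable_enorm_inner (hg k) f).aemeasurable,
    lintegral_tsum hprod]
  refine tsum_congr fun k => ?_
  simp_rw [enorm_inner_translateL2 (hg k)]
  exact lintegral_enorm_fourier_crossSpectrum (hg k) f

lemma lintegral_windowedEnergy {g : K → L2 m} (hg : ∀ k, Integrable (fun x => g k x))
    {Ω : Set ℝ} (hΩ : MeasurableSet Ω) (f : L2 m) :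
    ∫⁻ z, windowedEnergy g Ω f z
      = (∫⁻ t, (∑' k, ‖𝓕 (fun x => g k x) t‖ₑ ^ 2) * ‖(𝓕 f : L2 m) t‖ₑ ^ 2) * volume Ω := by
  rw [← lintegral_translateEnergy hg, Measure.volume_eq_prod]
  simp only [windowedEnergy]
  rw [lintegral_prod_mul (measurable_translateEnergy hg f).aemeasurable
    (measurable_const.indicator hΩ).aemeasurable, lintegral_indicator_const hΩ, one_mul]

/-- The correlation `∑ₖ conj ĝₖ(t) ĝₖ(t - a)` of the Fourier transforms. -/
noncomputable def spectralCorrelation (g : K → L2 m) (a t : Rm m) : ℂ :=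
  ∑' k, (starRingEnd ℂ) (𝓕 (fun x => g k x) t) * 𝓕 (fun x => g k x) (t - a)

lemma summable_norm_conj_mul {x y : K → ℂ} {C : ℝ} (hx : HasSum (fun k => ‖x k‖ ^ 2) C)
    (hy : HasSum (fun k => ‖y k‖ ^ 2) C) :
    Summable (fun k => ‖(starRingEnd ℂ) (x k) * y k‖) ∧
      ∑' k, ‖(starRingEnd ℂ) (x k) * y k‖ ≤ C := by
  have hle : ∀ k, ‖(starRingEnd ℂ) (x k) * y k‖ ≤ (‖x k‖ ^ 2 + ‖y k‖ ^ 2) / 2 := fun k => by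
    rw [norm_mul, RCLike.norm_conj]
    linarith [two_mul_le_add_sq ‖x k‖ ‖y k‖]
  have hs := (hx.add hy).div_const 2
  have h1 := Summable.of_nonneg_of_le (fun _ => norm_nonneg _) hle hs.summable
  refine ⟨h1, ?_⟩
  calc _ ≤ _ := h1.tsum_le_tsum hle hs.summable
    _ = C := by rw [hs.tsum_eq]; ring

lemma ae_summable_spectralCorrelation {g : K → L2 m} {C : ℝ} (hC : 0 ≤ C)
    (h : ∀ᵐ t : Rm m, ∑' k, ‖𝓕 (fun x => g k x) t‖ₑ ^ 2 = ENNReal.ofReal C) (a : Rm m) :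
    ∀ᵐ t : Rm m, Summable (fun k =>
        ‖(starRingEnd ℂ) (𝓕 (fun x => g k x) t) * 𝓕 (fun x => g k x) (t - a)‖) ∧
      ‖spectralCorrelation g a t‖ ≤ C := by
  have h' := (measurePreserving_sub_right volume a).quasiMeasurePreserving.ae h
  filter_upwards [h, h'] with t h1 h2
  rw [← hasSum_sq_iff _ hC] at h1 h2
  obtain ⟨h3, h4⟩ := summable_norm_conj_mul h1 h2
  exact ⟨h3, (norm_tsum_le_tsum_norm h3).trans h4⟩

lemma measurable_spectralCorrelation {g : K → L2 m} (hg : ∀ k, Integrable (fun x => g k x))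
    (a : Rm m) : Measurable (spectralCorrelation g a) := by
  refine Measurable.tsum fun k => ?_
  have hc := continuous_fourier (hg k)
  exact ((Complex.continuous_conj.comp hc).mul
    (hc.comp (continuous_id.sub continuous_const))).measurable

/-- Fourier transform of a squared modulus, by Plancherel's formula. -/
lemma integral_norm_fourier_sq_mul_char {h : Rm m → ℂ} (hh : Integrable h) (hh2 : MemLp h 2)
    (a : Rm m) :
    ∫ y, ((‖𝓕 h y‖ ^ 2 : ℝ) : ℂ) * (Real.fourierChar (-inner ℝ y a) : ℂ)
      = ∫ t, (starRingEnd ℂ) (h t) * h (t - a) := by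
  have hha : Integrable (fun t => h (t - a)) := hh.comp_sub_right a
  have hha2 : MemLp (fun t => h (t - a)) 2 volume :=
    hh2.comp_measurePreserving (measurePreserving_sub_right volume a)
  rw [← integral_conj_fourier_mul_fourier hh hh2 hha hha2]
  refine integral_congr_ae (.of_forall fun y => ?_)
  simp only [fourier_comp_sub_right, real_inner_comm]
  have : ((‖𝓕 h y‖ ^ 2 : ℝ) : ℂ) = (starRingEnd ℂ) (𝓕 h y) * 𝓕 h y := by
    rw [← Complex.normSq_eq_conj_mul_self, Complex.normSq_eq_norm_sq]
  rw [this]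
  ring

/-- The Fourier transform of `y ↦ ∑ₖ |⟨f, T_y gₖ⟩|²` in terms of the spectral correlation. -/
lemma integral_translateEnergy_mul_char {g : K → L2 m} (hg : ∀ k, Integrable (fun x => g k x))
    (f : L2 m) (hfin : ∫⁻ y, translateEnergy g f y ≠ ∞) (a : Rm m) :
    ∫ y, ((translateEnergy g f y).toReal : ℂ) * (Real.fourierChar (-inner ℝ y a) : ℂ)
      = ∫ t, spectralCorrelation g a t *
          ((𝓕 f : L2 m) t * (starRingEnd ℂ) ((𝓕 f : L2 m) (t - a))) := by
  have hne : ∀ᵐ y, translateEnergy g f y < ∞ :=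
    ae_lt_top (measurable_translateEnergy hg f) hfin
  have hsq : ∑' k, ∫⁻ y, ‖𝓕 (crossSpectrum (g k) f) y‖ₑ ^ 2 ≠ ∞ := by
    rw [← lintegral_tsum fun k => by
      simpa only [enorm_inner_translateL2 (hg k)] using (measurable_enorm_inner (hg k) f).aemeasurable]
    simpa only [translateEnergy, enorm_inner_translateL2 (hg _)] using hfin
  have hchar : Measurable fun y : Rm m => (Real.fourierChar (-inner ℝ y a) : ℂ) :=
    (continuous_subtype_val.comp (Real.continuous_fourierChar.comp (by fun_prop))).measurable
  have hcont : ∀ k, Continuous (𝓕 (crossSpectrum (g k) f)) := fun k =>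
    continuous_fourier (integrable_crossSpectrum (hg k) f)
  have e1 : ∀ᵐ y, ((translateEnergy g f y).toReal : ℂ) * (Real.fourierChar (-inner ℝ y a) : ℂ)
      = ∑' k, ((‖𝓕 (crossSpectrum (g k) f) y‖ ^ 2 : ℝ) : ℂ) *
          (Real.fourierChar (-inner ℝ y a) : ℂ) := by
    filter_upwards [hne] with y hy
    rw [tsum_mul_right, ← Complex.ofReal_tsum, translateEnergy, ENNReal.tsum_toReal_eq]
    · congr 3
      ext k
      rw [enorm_inner_translateL2 (hg k), ENNReal.toReal_pow, toReal_enorm]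
    · exact fun k => ne_top_of_le_ne_top hy.ne (ENNReal.le_tsum k)
  rw [integral_congr_ae e1, integral_tsum]
  · simp_rw [integral_norm_fourier_sq_mul_char (integrable_crossSpectrum (hg _) f)
      (memLp_two_crossSpectrum (hg _) f)]
    rw [← integral_tsum]
    · refine integral_congr_ae (.of_forall fun t => ?_)
      simp only [spectralCorrelation, ← tsum_mul_right]
      refine tsum_congr fun k => ?_
      simp only [crossSpectrum, map_mul, Complex.conj_conj]
      ring
    · intro k
      have h1 := (memLp_two_crossSpectrum (hg k) f)
      exact (Complex.continuous_conj.comp_aestronglyMeasurable h1.1).mul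
        (h1.comp_measurePreserving (measurePreserving_sub_right volume a)).1
    · refine ne_top_of_le_ne_top hsq (ENNReal.tsum_le_tsum fun k => ?_)
      set h := crossSpectrum (g k) f
      have hh2 : MemLp h 2 := memLp_two_crossSpectrum (hg k) f
      have hm : AEMeasurable (fun t => ‖h t‖ₑ ^ 2) (volume : Measure (Rm m)) :=
        hh2.1.enorm.pow_const 2
      rw [lintegral_enorm_fourier_sq (integrable_crossSpectrum (hg k) f) hh2]
      have hpt : ∀ t, ‖(starRingEnd ℂ) (h t) * h (t - a)‖ₑ
          ≤ 2⁻¹ * (‖h t‖ₑ ^ 2 + ‖h (t - a)‖ₑ ^ 2) := fun t => by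
        rw [← ofReal_norm, ← ofReal_norm, ← ofReal_norm, ← ENNReal.ofReal_pow (norm_nonneg _),
          ← ENNReal.ofReal_pow (norm_nonneg _), ← ENNReal.ofReal_add (by positivity) (by positivity),
          show (2⁻¹ : ℝ≥0∞) = ENNReal.ofReal 2⁻¹ by
            rw [ENNReal.ofReal_inv_of_pos two_pos]; simp,
          ← ENNReal.ofReal_mul (by norm_num), norm_mul, RCLike.norm_conj]
        refine ENNReal.ofReal_le_ofReal ?_
        linarith [two_mul_le_add_sq ‖h t‖ ‖h (t - a)‖]
      refine (lintegral_mono hpt).trans_eq ?_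
      rw [lintegral_const_mul' _ _ (by simp), lintegral_add_left' hm,
        lintegral_sub_right_eq_self (fun t => ‖h t‖ₑ ^ 2) a, ← two_mul, ← mul_assoc,
        ENNReal.inv_mul_cancel (by simp) (by simp), one_mul]
  · exact fun k => (((Complex.measurable_ofReal.comp
      ((hcont k).measurable.norm.pow_const 2)).mul hchar)).aestronglyMeasurable
  · refine ne_top_of_le_ne_top hsq (ENNReal.tsum_le_tsum fun k => lintegral_mono fun y => ?_)
    have h1 : ‖(Real.fourierChar (-inner ℝ y a) : ℂ)‖ₑ = 1 := by
      rw [← ofReal_norm, Circle.norm_coe, ENNReal.ofReal_one]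
    rw [enorm_mul, h1, mul_one, ← ofReal_norm, Complex.norm_real, Real.norm_of_nonneg (by positivity),
      ENNReal.ofReal_pow (norm_nonneg _), ofReal_norm]

lemma integral_windowedEnergy_prodChar {g : K → L2 m} (hg : ∀ k, Integrable (fun x => g k x))
    (f : L2 m) (hfin : ∫⁻ y, translateEnergy g f y ≠ ∞) {b : ℝ} (hb : 0 ≤ b) (η : Rm m × ℝ) :
    ∫ z, (windowedEnergy g (Set.Icc (-b) b) f z).toReal • prodChar η z =
      (2 * b * Real.sinc (Real.pi * (2 * b) * η.2) : ℝ) *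
        ∫ t, spectralCorrelation g η.1 t *
          ((𝓕 f : L2 m) t * (starRingEnd ℂ) ((𝓕 f : L2 m) (t - η.1))) := by
  rw [← integral_translateEnergy_mul_char hg f hfin, ← fourier_indicator_Icc hb, Real.fourier_eq,
    mul_comm, ← integral_prod_mul, Measure.volume_eq_prod]
  refine integral_congr_ae (.of_forall fun z => ?_)
  simp only [windowedEnergy, prodChar, ENNReal.toReal_mul, Complex.real_smul, Circle.smul_def,
    smul_eq_mul, neg_add, AddChar.map_add_eq_mul, Circle.coe_mul]
  by_cases hz : z.2 ∈ Set.Icc (-b) b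
  · simp only [Set.indicator_of_mem hz]
    simp [mul_comm, mul_left_comm]
  · simp [Set.indicator_of_notMem hz]

end Spectrum

/-! ### The characterization -/

section Characterization

variable {m : ℕ} {K : Type*} [Countable K] {Γ : Submodule ℤ (Rm m × ℝ)} [DiscreteTopology Γ]
  [IsZLattice ℝ Γ]

/-- The zeroth Fourier coefficient: constant periodizations force `∑ₖ |ĝₖ|²` to be constant. -/
lemma ae_tsum_enorm_fourier_sq_eq {g : K → L2 m} (hg : ∀ k, Integrable (fun x => g k x)) {b : ℝ}
    (hb : 0 < b) (h : ∀ f : L2 m, ∀ᵐ z : Rm m × ℝ,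
      periodize Γ (windowedEnergy g (Set.Icc (-b) b) f) z = ENNReal.ofReal (‖f‖ ^ 2)) :
    ∀ᵐ t : Rm m, ∑' k, ‖𝓕 (fun x => g k x) t‖ₑ ^ 2
      = ENNReal.ofReal (ZLattice.covolume Γ volume / (2 * b)) := by
  obtain ⟨F, hF, -, -, hvol, -⟩ := exists_fundamentalDomain Γ volume
  set V := ZLattice.covolume Γ (volume : Measure (Rm m × ℝ))
  have hmeas : Measurable fun t : Rm m => ∑' k, ‖𝓕 (fun x => g k x) t‖ₑ ^ 2 :=
    Measurable.tsum fun k => (measurable_fourier_coeFn (hg k)).enorm.pow_const 2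
  refine ae_eq_of_forall_setLIntegral_eq_of_sigmaFinite hmeas measurable_const fun s hs hμs => ?_
  have hind : MemLp (s.indicator fun _ => (1 : ℂ)) 2 (volume : Measure (Rm m)) :=
    memLp_indicator_const 2 hs _ (Or.inr hμs.ne)
  set u : L2 m := hind.toLp _ with hu
  set f : L2 m := (Lp.fourierTransformₗᵢ (Rm m) ℂ).symm u with hf
  have hfu : (𝓕 f : L2 m) = u := (Lp.fourierTransformₗᵢ (Rm m) ℂ).apply_symm_apply u
  have hsq : ∀ᵐ t, ‖(𝓕 f : L2 m) t‖ₑ ^ 2 = s.indicator (fun _ => 1) t := by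
    filter_upwards [hind.coeFn_toLp] with t ht
    rw [hfu, hu, ht]
    by_cases hts : t ∈ s <;> simp [hts]
  have hnorm : ENNReal.ofReal (‖f‖ ^ 2) = volume s := by
    rw [← Lp.norm_fourier_eq f, ← lintegral_enorm_sq_Lp, lintegral_congr_ae hsq,
      lintegral_indicator_const hs, one_mul]
  have h1 := setLIntegral_periodize hF
    (measurable_windowedEnergy hg (Ω := Set.Icc (-b) b) measurableSet_Icc f)
  rw [lintegral_congr_ae (ae_restrict_of_ae (h f)), setLIntegral_const, hvol, hnorm,
    lintegral_windowedEnergy hg measurableSet_Icc, Real.volume_Icc] at h1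
  have h2 : ∫⁻ t, (∑' k, ‖𝓕 (fun x => g k x) t‖ₑ ^ 2) * ‖(𝓕 f : L2 m) t‖ₑ ^ 2
      = ∫⁻ t in s, ∑' k, ‖𝓕 (fun x => g k x) t‖ₑ ^ 2 := by
    rw [← lintegral_indicator hs]
    refine lintegral_congr_ae ?_
    filter_upwards [hsq] with t ht
    rw [ht]
    by_cases hts : t ∈ s <;> simp [hts]
  rw [h2, show b - -b = 2 * b by ring] at h1
  rw [setLIntegral_const, ENNReal.ofReal_div_of_pos (by positivity), div_eq_mul_inv, mul_right_comm,
    mul_comm (ENNReal.ofReal V), h1, ← div_eq_mul_inv,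
    ENNReal.mul_div_cancel_right (by simpa using hb) ENNReal.ofReal_ne_top]

lemma lintegral_translateEnergy_of_ae_eq {g : K → L2 m} (hg : ∀ k, Integrable (fun x => g k x)) {C : ℝ}
    (hC : ∀ᵐ t : Rm m, ∑' k, ‖𝓕 (fun x => g k x) t‖ₑ ^ 2 = ENNReal.ofReal C) (f : L2 m) :
    ∫⁻ y, translateEnergy g f y = ENNReal.ofReal C * ENNReal.ofReal (‖f‖ ^ 2) := by
  rw [lintegral_translateEnergy hg, ← Lp.norm_fourier_eq f, ← lintegral_enorm_sq_Lp,
    ← lintegral_const_mul' _ _ ENNReal.ofReal_ne_top]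
  refine lintegral_congr_ae ?_
  filter_upwards [hC] with t ht
  rw [ht]

lemma integral_fourier_mul_conj (f : L2 m) :
    ∫ t, (𝓕 f : L2 m) t * (starRingEnd ℂ) ((𝓕 f : L2 m) t) = ((‖f‖ ^ 2 : ℝ) : ℂ) := by
  have h1 := L2.inner_def (𝕜 := ℂ) (𝓕 f : L2 m) (𝓕 f : L2 m)
  rw [Lp.inner_fourier_eq, inner_self_eq_norm_sq_to_K] at h1
  simp only [RCLike.inner_apply] at h1
  rw [← h1]
  push_cast
  rfl

/-- The conditions on the functions `ĝₖ` say that, for all `f`, the Fourier coefficients of the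
periodization are those of the constant `‖f‖²`. -/
lemma forall_periodize_iff {g : K → L2 m} (hg : ∀ k, Integrable (fun x => g k x)) {b : ℝ}
    (hb : 0 < b) :
    (∀ f : L2 m, ∀ᵐ z : Rm m × ℝ,
      periodize Γ (windowedEnergy g (Set.Icc (-b) b) f) z = ENNReal.ofReal (‖f‖ ^ 2)) ↔
    ∀ η ∈ dualLattice Γ, ∀ᵐ t : Rm m,
      Summable (fun k => (starRingEnd ℂ) (𝓕 (fun x => g k x) t) * 𝓕 (fun x => g k x) (t - η.1)) ∧
      ((2 * b / ZLattice.covolume Γ volume : ℝ) : ℂ) *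
        (Real.sinc (Real.pi * (2 * b) * η.2) : ℂ) * spectralCorrelation g η.1 t
          = kroneckerZero η := by
  set V := ZLattice.covolume Γ (volume : Measure (Rm m × ℝ)) with hVdef
  have hV : 0 < V := ZLattice.covolume_pos Γ (volume : Measure (Rm m × ℝ))
  have hVC : (V : ℂ) ≠ 0 := by exact_mod_cast hV.ne'
  have hbC : (b : ℂ) ≠ 0 := by exact_mod_cast hb.ne'
  have hC0 : 0 ≤ V / (2 * b) := by positivity
  constructor
  · intro h η hη
    have hC := ae_tsum_enorm_fourier_sq_eq hg hb h
    have hsum := ae_summable_spectralCorrelation hC0 hC η.1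
    suffices hmain : ∀ᵐ t : Rm m, ((2 * b / V : ℝ) : ℂ) *
        (Real.sinc (Real.pi * (2 * b) * η.2) : ℂ) * spectralCorrelation g η.1 t
          = kroneckerZero η by
      filter_upwards [hsum, hmain] with t h1 h2
      exact ⟨h1.1.of_norm, h2⟩
    by_cases hη0 : η = 0
    · subst hη0
      filter_upwards [hC] with t ht
      rw [← hasSum_sq_iff _ hC0] at ht
      have e : spectralCorrelation g 0 t = ((V / (2 * b) : ℝ) : ℂ) := by
        rw [← ht.tsum_eq, Complex.ofReal_tsum]
        refine tsum_congr fun k => ?_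
        rw [sub_zero, ← Complex.normSq_eq_conj_mul_self, Complex.normSq_eq_norm_sq]
      simp only [Prod.fst_zero, Prod.snd_zero, e, kroneckerZero, mul_zero, Real.sinc_zero, if_true]
      push_cast
      field_simp
    · rw [kroneckerZero, if_neg hη0]
      by_cases hs : Real.sinc (Real.pi * (2 * b) * η.2) = 0
      · exact .of_forall fun t => by simp [hs]
      have hzero : spectralCorrelation g η.1 =ᵐ[volume] 0 := by
        refine ae_eq_zero_of_quadratic_form
          (measurable_spectralCorrelation hg η.1).aestronglyMeasurable
          (hsum.mono fun t ht => ht.2) η.1 fun u hu => ?_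
        set f : L2 m := (Lp.fourierTransformₗᵢ (Rm m) ℂ).symm (hu.toLp u) with hf
        have hfu : (𝓕 f : L2 m) = hu.toLp u :=
          (Lp.fourierTransformₗᵢ (Rm m) ℂ).apply_symm_apply _
        have hfin : ∫⁻ y, translateEnergy g f y ≠ ∞ := by
          rw [lintegral_translateEnergy_of_ae_eq hg hC]
          exact ENNReal.mul_ne_top ENNReal.ofReal_ne_top ENNReal.ofReal_ne_top
        have h1 := integral_prodChar_of_periodize_eq
          (measurable_windowedEnergy hg measurableSet_Icc f) ENNReal.ofReal_ne_top (h f) hη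
        rw [integral_windowedEnergy_prodChar hg f hfin hb.le, kroneckerZero, if_neg hη0, mul_zero,
          mul_eq_zero, Complex.ofReal_eq_zero] at h1
        have h2 := h1.resolve_left (mul_ne_zero (by positivity) hs)
        rw [← h2]
        have h3 := (measurePreserving_sub_right volume η.1).quasiMeasurePreserving.ae
          hu.coeFn_toLp
        refine integral_congr_ae ?_
        filter_upwards [hu.coeFn_toLp, h3] with t h4 h5
        rw [hfu, h4, h5]
      filter_upwards [hzero] with t ht
      rw [ht, Pi.zero_apply, mul_zero]
  · intro h f
    have hC : ∀ᵐ t : Rm m, ∑' k, ‖𝓕 (fun x => g k x) t‖ₑ ^ 2 = ENNReal.ofReal (V / (2 * b)) := by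
      have h0 : (0 : Rm m × ℝ) ∈ dualLattice Γ := fun γ _ => ⟨0, by simp⟩
      filter_upwards [h 0 h0] with t ⟨h1, h2⟩
      rw [← hasSum_sq_iff _ hC0]
      have e : ∀ k, (starRingEnd ℂ) (𝓕 (fun x => g k x) t) * 𝓕 (fun x => g k x) (t - 0)
          = ((‖𝓕 (fun x => g k x) t‖ ^ 2 : ℝ) : ℂ) := fun k => by
        rw [sub_zero, ← Complex.normSq_eq_conj_mul_self, Complex.normSq_eq_norm_sq]
      simp only [Prod.fst_zero, Prod.snd_zero, e, kroneckerZero, mul_zero, Real.sinc_zero,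
        if_true, spectralCorrelation] at h1 h2
      rw [← Complex.hasSum_ofReal]
      convert h1.hasSum using 1
      push_cast at h2 ⊢
      field_simp at h2 ⊢
      linear_combination -h2
    have hfin : ∫⁻ y, translateEnergy g f y ≠ ∞ := by
      rw [lintegral_translateEnergy_of_ae_eq hg hC]
      exact ENNReal.mul_ne_top ENNReal.ofReal_ne_top ENNReal.ofReal_ne_top
    have hfinW : ∫⁻ z, windowedEnergy g (Set.Icc (-b) b) f z ≠ ∞ := by
      rw [lintegral_windowedEnergy hg measurableSet_Icc, ← lintegral_translateEnergy hg]
      exact ENNReal.mul_ne_top hfin (by simp)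
    refine periodize_eq_of_integral_prodChar (measurable_windowedEnergy hg measurableSet_Icc f)
      hfinW ENNReal.ofReal_ne_top fun η hη => ?_
    have e : ∀ᵐ t : Rm m, ((2 * b * Real.sinc (Real.pi * (2 * b) * η.2) : ℝ) : ℂ) *
        (spectralCorrelation g η.1 t *
          ((𝓕 f : L2 m) t * (starRingEnd ℂ) ((𝓕 f : L2 m) (t - η.1))))
        = V * kroneckerZero η * ((𝓕 f : L2 m) t * (starRingEnd ℂ) ((𝓕 f : L2 m) (t - η.1))) := by
      filter_upwards [h η hη] with t ⟨_, h2⟩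
      rw [← h2]
      push_cast
      field_simp
    rw [integral_windowedEnergy_prodChar hg f hfin hb.le, ← integral_const_mul,
      integral_congr_ae e, integral_const_mul, ENNReal.toReal_ofReal (by positivity)]
    by_cases hη0 : η = 0
    · subst hη0
      simp only [Prod.fst_zero, sub_zero]
      rw [integral_fourier_mul_conj f]
      ring
    · simp [kroneckerZero, hη0]

lemma IsSimpleWindow.eq_Icc {Ω : Set ℝ} (hΩ : IsSimpleWindow Ω) (hsymm : -Ω = Ω) :
    ∃ b : ℝ, 0 < b ∧ Ω = Set.Icc (-b) b := by
  have hIcc := eq_Icc_of_connected_compact ⟨hΩ.nonempty, hΩ.ordConnected.isPreconnected⟩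
    hΩ.isCompact
  have ha := hΩ.isCompact.sInf_mem hΩ.nonempty
  have hb := hΩ.isCompact.sSup_mem hΩ.nonempty
  set a := sInf Ω
  set b := sSup Ω
  have hna : -a ∈ Ω := by rw [← hsymm]; simpa using ha
  have hnb : -b ∈ Ω := by rw [← hsymm]; simpa using hb
  rw [hIcc] at hna hnb
  have hab : a = -b := le_antisymm hnb.1 (by linarith [hna.2])
  rw [hab] at hIcc
  refine ⟨b, ?_, hIcc⟩
  by_contra hle
  have h1 : interior Ω = ∅ := by
    rw [hIcc, interior_Icc, Set.Ioo_eq_empty (by linarith)]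
  have h2 := hΩ.closure_interior
  rw [h1, closure_empty] at h2
  exact hΩ.nonempty.ne_empty h2.symm

end Characterization

end ModelSetFrames

theorem theorem4p7 {m : ℕ} {K : Type*} [Countable K]
    (Γ : Submodule ℤ (ModelSetFrames.Rm m × ℝ)) [DiscreteTopology Γ] [IsZLattice ℝ Γ]
    (hΓ : ModelSetFrames.IsCutAndProject Γ)
    (Ω : Set ℝ) (hΩ : ModelSetFrames.IsSimpleWindow Ω) (hsymm : -Ω = Ω)
    (hgen : ModelSetFrames.IsGeneric Γ Ω)
    (ε : ℝ) (hε0 : 0 < ε) (hε1 : ε < 1)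
    (g : K → ModelSetFrames.L2 m) (hg : ∀ k, ModelSetFrames.MemWiener 2 1 (g k)) :
    ∃ (D : ℝ) (Ψ : ℝ → ℝ),
      ModelSetFrames.HasDensity (ModelSetFrames.modelSet Γ Ω) D ∧
      TendstoUniformly (ModelSetFrames.psiHat ε Ω) Ψ atTop ∧
      (ModelSetFrames.IsNormalizedTightFrame
          (fun i : K × ModelSetFrames.modelSet Γ Ω =>
            ModelSetFrames.translateL2 (i.2 : ModelSetFrames.Rm m) (g i.1)) ↔
        ∀ η ∈ ModelSetFrames.dualLattice Γ, ∀ᵐ t : ModelSetFrames.Rm m,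
          Summable (fun k => (starRingEnd ℂ) (𝓕 (fun x => g k x) t) *
            𝓕 (fun x => g k x) (t - η.1)) ∧
          (D : ℂ) * (ModelSetFrames.Phi Ω Ψ (-η.2) : ℂ) *
            ∑' k, (starRingEnd ℂ) (𝓕 (fun x => g k x) t) *
              𝓕 (fun x => g k x) (t - η.1) = ModelSetFrames.kroneckerZero η) := by
  obtain ⟨b, hb, rfl⟩ := hΩ.eq_Icc hsymm
  have hint := fun k => (hg k).integrable
  have hvol : volume.real (Set.Icc (-b) b) = 2 * b := by
    rw [Real.volume_real_Icc_of_le (by linarith)]; ring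
  have hab : -b < b := by linarith
  have hmem : -b ∉ Prod.snd '' (Γ : Set (ModelSetFrames.Rm m × ℝ)) := by
    rintro ⟨γ, hγ, h⟩
    refine hgen γ hγ ?_
    rw [h, frontier_Icc hab.le]
    exact Set.mem_insert _ _
  refine ⟨2 * b / ZLattice.covolume Γ volume,
    fun t => Real.sinc (Real.pi * volume.real (Set.Icc (-b) b) * t), ?_,
    ModelSetFrames.tendstoUniformly_psiHat hε0 hε1 _, ?_⟩
  · have := ModelSetFrames.hasDensity_modelSet hΓ hab.le
    rwa [show b - -b = 2 * b by ring] at this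
  · rw [ModelSetFrames.isNormalizedTightFrame_iff_ae hΓ g hab hmem,
      ModelSetFrames.forall_periodize_iff hint hb]
    refine forall₂_congr fun η _ => ?_
    rw [ModelSetFrames.Phi_Icc hb, hvol, mul_neg, Real.sinc_neg]
    rfl
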